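/- Let $\pi:\mathbb{R}^d\to(0,\infty)$ be a probability density with $\log\pi$ differentiable, and let $G(\theta,\mathcal U)$ be a (jointly measurable) unbiased estimate of $\nabla\log\pi(\theta)$: $\mathbb{E}[H(\theta,\mathcal U)]=0$ for every $\theta$, where $H(\theta,\mathcal U)=G(\theta,\mathcal U)-\nabla\log\pi(\theta)$ and $\mathcal U$ is an auxiliary random variable. Assume that the drift $\theta\mapsto\frac12\nabla\log\pi(\theta)$ is continuous and that there is a function $V:\mathbb{R}^d\to[1,\infty)$, tending to infinity as $\|\theta\|\to\infty$, twice differentiable with bounded second derivatives, such that 1. for some exponent $p_H\ge 2$ and some constant $C>0$, $\mathbb{E}\big[\|H(\theta,\mathcal U)\|^{2p_H}\big]\le C\,V(\theta)^{p_H}$ for all $\theta$; 2. for some constant $C>0$, $\|\nabla V(\theta)\|^2+\|\nabla\log\pi(\theta)\|^2\le C\,V(\theta)$ for all $\theta$; 3. for some $\alpha,\beta>0$, $\frac12\langle\nabla V(\theta),\nabla\log\pi(\theta)\rangle\le-\alpha V(\theta)+\beta$ for all $\theta$. Suppose moreover that the drift $\frac12\nabla\log\pi$ is globally Lipschitz on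 $\mathbb{R}^d$. Fix $\theta_0\in\mathbb{R}^d$ and $T>0$, let $W$ be a standard Brownian motion in $\mathbb{R}^d$, and let $(\mathcal U^{(r)}_k)_{r\ge1,k\ge1}$ be i.i.d. copies of $\mathcal U$, independent of $W$. For each $r$ let $\delta^{(r)}_1,\dots,\delta^{(r)}_{m(r)}>0$ be step-sizes with $\sum_{k=1}^{m(r)}\delta^{(r)}_k=T$, put $T^{(r)}_k=\delta^{(r)}_1+\dots+\delta^{(r)}_k$, $\eta^{(r)}_k=(\delta^{(r)}_k)^{-1/2}\big(W(T^{(r)}_k)-W(T^{(r)}_{k-1})\big)$, and define the SGLD chain by $\theta^{(r)}_0=\theta_0$ and $$\theta^{(r)}_k=\theta^{(r)}_{k-1}+\tfrac12\,\delta^{(r)}_k\,\big\{\nabla\log\pi(\theta^{(r)}_{k-1})+H(\theta^{(r)}_{k-1},\mathcal U^{(r)}_k)\big\}+(\delta^{(r)}_k)^{1/2}\,\eta^{(r)}_k .$$ Let $S^{(r)}:[0,T]\to\mathbb{R}^d$ be its piecewise linear interpolation, $S^{(r)}\big(xT^{(r)}_{k-1}+(1-x)T^{(r)}_k\big)=x\,\theta^{(r)}_{k-1}+(1-x)\,\theta^{(r)}_k$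 for $x\in[0,1]$ and $1\le k\le m(r)$. If $\max_{1\le k\le m(r)}\delta^{(r)}_k\to0$ as $r\to\infty$, then $S^{(r)}$ converges weakly on $\big(C([0,T],\mathbb{R}^d),\|\cdot\|_\infty\big)$ to the Langevin diffusion started at $\theta_0$: the equation $dX_t=\frac12\nabla\log\pi(X_t)\,dt+dW_t$, $X_0=\theta_0$, has a solution on $[0,T]$ driven by $W$, and $S^{(r)}$ converges in distribution to every solution on $[0,T]$ of this equation, on whatever probability space and for whatever standard Brownian motion it is defined. -/

import Mathlib

open MeasureTheory ProbabilityTheory Filter Topology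
open scoped NNReal ENNReal

namespace SGLD

noncomputable section

/-- Path space `C([0,T], ℝ^d)`; its topology is that of the supremum norm. -/
abbrev PathSpace (d : ℕ) (T : ℝ) : Type :=
  C(Set.Icc (0 : ℝ) T, EuclideanSpace ℝ (Fin d))

/-- Path space carries its Borel σ-algebra. -/
instance instMeasurableSpacePathSpace (d : ℕ) (T : ℝ) : MeasurableSpace (PathSpace d T) :=
  borel _

instance instBorelSpacePathSpace (d : ℕ) (T : ℝ) : BorelSpace (PathSpace d T) := ⟨rfl⟩

/-- `W` is a standard Brownian motion in `ℝ^d`: its coordinates are independent standard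
real Brownian motions. -/
structure IsStandardBM {d : ℕ} {Ω : Type*} [MeasurableSpace Ω]
    (W : ℝ≥0 → Ω → EuclideanSpace ℝ (Fin d)) (P : Measure Ω) : Prop where
  measurable : ∀ t, Measurable (W t)
  coord : ∀ i : Fin d, IsBrownianReal (fun t ω ↦ W t ω i) P
  indep : iIndepFun (fun (i : Fin d) (ω : Ω) (t : ℝ≥0) ↦ W t ω i) P

/-- `π` is a positive probability density on `ℝ^d` with respect to Lebesgue measure. -/
structure IsPositiveDensity {d : ℕ} (π : EuclideanSpace ℝ (Fin d) → ℝ) : Prop where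
  pos : ∀ θ, 0 < π θ
  integrable : Integrable π
  integral_eq_one : ∫ θ, π θ = 1

/-- The score `∇ log π`. -/
def gradLog {d : ℕ} (π : EuclideanSpace ℝ (Fin d) → ℝ) (θ : EuclideanSpace ℝ (Fin d)) :
    EuclideanSpace ℝ (Fin d) :=
  gradient (fun x ↦ Real.log (π x)) θ

/-- The drift `½ ∇ log π` of the Langevin diffusion. -/
def drift {d : ℕ} (π : EuclideanSpace ℝ (Fin d) → ℝ) (θ : EuclideanSpace ℝ (Fin d)) :
    EuclideanSpace ℝ (Fin d) :=
  (1 / 2 : ℝ) • gradLog π θ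

/-- `G θ U` is an unbiased estimate of `∇ log π (θ)`, where `U` has law `ν`. -/
structure IsUnbiasedEstimate {d : ℕ} {𝒰 : Type*} [MeasurableSpace 𝒰]
    (π : EuclideanSpace ℝ (Fin d) → ℝ)
    (G : EuclideanSpace ℝ (Fin d) → 𝒰 → EuclideanSpace ℝ (Fin d)) (ν : Measure 𝒰) : Prop where
  measurable : Measurable (Function.uncurry G)
  integrable : ∀ θ, Integrable (G θ) ν
  integral_eq : ∀ θ, ∫ u, G θ u ∂ν = gradLog π θ

/-- The stability assumption for the Lyapunov function `V`, where
`H θ u = G θ u - ∇ log π (θ)` is the error of the stochastic gradient. -/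
structure IsLyapunov {d : ℕ} {𝒰 : Type*} [MeasurableSpace 𝒰]
    (π : EuclideanSpace ℝ (Fin d) → ℝ)
    (G : EuclideanSpace ℝ (Fin d) → 𝒰 → EuclideanSpace ℝ (Fin d)) (ν : Measure 𝒰)
    (V : EuclideanSpace ℝ (Fin d) → ℝ) : Prop where
  one_le : ∀ θ, 1 ≤ V θ
  tendsto_atTop : Tendsto V (cocompact (EuclideanSpace ℝ (Fin d))) atTop
  differentiable : Differentiable ℝ V
  differentiable_fderiv : Differentiable ℝ (fderiv ℝ V)
  bounded_second : ∃ C : ℝ, ∀ θ, ‖fderiv ℝ (fderiv ℝ V) θ‖ ≤ C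
  moment_error : ∃ pH : ℝ, 2 ≤ pH ∧ ∃ C : ℝ, 0 < C ∧ ∀ θ,
    ∫⁻ u, ‖G θ u - gradLog π θ‖ₑ ^ (2 * pH) ∂ν ≤ ENNReal.ofReal (C * V θ ^ pH)
  size : ∃ C : ℝ, 0 < C ∧ ∀ θ, ‖gradient V θ‖ ^ 2 + ‖gradLog π θ‖ ^ 2 ≤ C * V θ
  drift_le : ∃ α β : ℝ, 0 < α ∧ 0 < β ∧ ∀ θ,
    (1 / 2 : ℝ) * inner ℝ (gradient V θ) (gradLog π θ) ≤ -α * V θ + β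

/-- The stability assumption: `log π` is differentiable, the drift `½ ∇ log π` is continuous
and a Lyapunov function exists. -/
def StabilityAssumption {d : ℕ} {𝒰 : Type*} [MeasurableSpace 𝒰]
    (π : EuclideanSpace ℝ (Fin d) → ℝ)
    (G : EuclideanSpace ℝ (Fin d) → 𝒰 → EuclideanSpace ℝ (Fin d)) (ν : Measure 𝒰) : Prop :=
  Differentiable ℝ (fun θ ↦ Real.log (π θ)) ∧ Continuous (drift π) ∧
    ∃ V : EuclideanSpace ℝ (Fin d) → ℝ, IsLyapunov π G ν V

/-- The times `T_k = δ_1 + ⋯ + δ_k`. Step-sizes are indexed from zero here: `δ k` is the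
`(k+1)`-st step-size. -/
def time (δ : ℕ → ℝ) (k : ℕ) : ℝ := ∑ j ∈ Finset.range k, δ j

/-- The largest of the first `m` step-sizes. -/
def mesh (δ : ℕ → ℝ) (m : ℕ) : ℝ := ⨆ k : Fin m, δ k

/-- The normalised increments of `w` (a path of the Brownian motion) over the steps. -/
def noise {d : ℕ} (w : ℝ≥0 → EuclideanSpace ℝ (Fin d)) (δ : ℕ → ℝ) (k : ℕ) :
    EuclideanSpace ℝ (Fin d) :=
  (√(δ k))⁻¹ • (w (time δ (k + 1)).toNNReal - w (time δ k).toNNReal)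

/-- The SGLD recursion with step-sizes `δ`, auxiliary variables `u` and noises `η`
(all indexed from zero). -/
def chain {d : ℕ} {𝒰 : Type*}
    (G : EuclideanSpace ℝ (Fin d) → 𝒰 → EuclideanSpace ℝ (Fin d))
    (θ₀ : EuclideanSpace ℝ (Fin d)) (δ : ℕ → ℝ) (u : ℕ → 𝒰)
    (η : ℕ → EuclideanSpace ℝ (Fin d)) : ℕ → EuclideanSpace ℝ (Fin d)
  | 0 => θ₀
  | k + 1 => chain G θ₀ δ u η k + ((1 / 2 : ℝ) * δ k) • G (chain G θ₀ δ u η k) (u k)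
      + √(δ k) • η k

/-- The continuous path on `[0,T]` that interpolates linearly between the values `θ k` at the
times `T_k`, `k ≤ m`: on the `k`-th step it moves by the elapsed fraction of that step times
`θ (k+1) - θ k`; see `interpolation_apply`. -/
def interpolation {d : ℕ} (T : ℝ) (δ : ℕ → ℝ) (m : ℕ) (θ : ℕ → EuclideanSpace ℝ (Fin d)) :
    PathSpace d T where
  toFun t := θ 0 + ∑ k ∈ Finset.range m,
    (max 0 (min 1 (((t : ℝ) - time δ k) / δ k))) • (θ (k + 1) - θ k)
  continuous_toFun := by fun_prop

theorem time_mono {δ : ℕ → ℝ} {m i j : ℕ} (hδ : ∀ k < m, 0 < δ k) (hij : i ≤ j) (hj : j ≤ m) :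
    time δ i ≤ time δ j := by
  unfold time
  apply Finset.sum_le_sum_of_subset_of_nonneg
  · exact Finset.range_mono hij
  · intro k hk _
    exact (hδ k (lt_of_lt_of_le (Finset.mem_range.1 hk) hj)).le

/-- The interpolated path takes the value `x θ_k + (1 - x) θ_{k+1}` at the time
`x T_k + (1 - x) T_{k+1}`, for `x ∈ [0,1]`. -/
theorem interpolation_apply {d : ℕ} {T : ℝ} {δ : ℕ → ℝ} {m : ℕ}
    (θ : ℕ → EuclideanSpace ℝ (Fin d)) (hδ : ∀ k < m, 0 < δ k) {k : ℕ} (hk : k < m)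
    {x : ℝ} (hx : x ∈ Set.Icc (0 : ℝ) 1)
    (ht : x * time δ k + (1 - x) * time δ (k + 1) ∈ Set.Icc (0 : ℝ) T) :
    interpolation T δ m θ ⟨x * time δ k + (1 - x) * time δ (k + 1), ht⟩
      = x • θ k + (1 - x) • θ (k + 1) := by
  obtain ⟨hx0, hx1⟩ := hx
  have hs : ∀ j, time δ (j + 1) = time δ j + δ j := fun j ↦ Finset.sum_range_succ _ _
  have hδk := hδ k hk
  have key : ∀ n, n ≤ m → θ 0 + ∑ j ∈ Finset.range n,
      (max 0 (min 1 ((x * time δ k + (1 - x) * time δ (k + 1) - time δ j) / δ j))) •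
        (θ (j + 1) - θ j) = if n ≤ k then θ n else x • θ k + (1 - x) • θ (k + 1) := by
    intro n
    induction n with
    | zero => intro _; simp
    | succ n ih =>
      intro hn
      have hδn := hδ n (by omega)
      rw [Finset.sum_range_succ, ← add_assoc, ih (by omega)]
      rcases lt_trichotomy n k with h | h | h
      · have h1 : time δ (n + 1) ≤ time δ k := time_mono hδ h hk.le
        have h2 : 1 ≤ (x * time δ k + (1 - x) * time δ (k + 1) - time δ n) / δ n := by
          rw [le_div_iff₀ hδn, hs k]
          rw [hs n] at h1
          nlinarith
        rw [if_pos h.le, if_pos (Nat.succ_le_of_lt h), min_eq_left h2]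
        simp
      · subst h
        have h2 : (x * time δ n + (1 - x) * time δ (n + 1) - time δ n) / δ n = 1 - x := by
          rw [hs n]
          field_simp
          ring
        rw [if_pos le_rfl, if_neg (by omega), h2, min_eq_right (by linarith),
          max_eq_right (by linarith)]
        module
      · have h1 : time δ (k + 1) ≤ time δ n := time_mono hδ h (by omega)
        have h2 : (x * time δ k + (1 - x) * time δ (k + 1) - time δ n) / δ n ≤ 0 := by
          apply div_nonpos_of_nonpos_of_nonneg _ hδn.le
          rw [hs k] at h1 ⊢
          nlinarith
        rw [if_neg (by omega), if_neg (by omega), max_eq_left ((min_le_right _ _).trans h2)]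
        simp
  have := key m le_rfl
  rw [if_neg (by omega)] at this
  exact this

/-- `X` is, on `[0,T]`, a solution of the Langevin equation
`dX_t = ½ ∇ log π (X_t) dt + dW_t`, `X_0 = θ₀`, driven by the standard Brownian motion `W`.
As the noise is additive, this is an integral equation for the paths. -/
structure IsLangevinDiffusion {d : ℕ} {Ω : Type*} [MeasurableSpace Ω]
    (π : EuclideanSpace ℝ (Fin d) → ℝ) (θ₀ : EuclideanSpace ℝ (Fin d)) (T : ℝ) (hT : 0 ≤ T)
    (P : Measure Ω) (W : ℝ≥0 → Ω → EuclideanSpace ℝ (Fin d)) (X : Ω → PathSpace d T) :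
    Prop where
  brownian : IsStandardBM W P
  measurable : Measurable X
  integral_eq : ∀ᵐ ω ∂P, ∀ t : Set.Icc (0 : ℝ) T,
    X ω t = θ₀ + (∫ s in (0 : ℝ)..t, drift π (X ω (Set.projIcc 0 T hT s)))
      + W (t : ℝ).toNNReal ω

end

end SGLD

/-!
Since the noise is additive, the solution of `dX = b(X) dt + dW` is a continuous function of the
path of `W`, which gives both the existence of a solution and the uniqueness of its law. The SGLD
chain is an Euler scheme for the same equation, perturbed by the accumulated gradient errors, so a
pathwise Grönwall argument reduces the theorem to showing that these errors tend to zero uniformly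
on `[0, T]`, in probability. Conditionally on the past of the chain *and the whole path of `W`*,
each gradient error is centred; hence the errors are martingale differences, and Doob's maximal
inequality bounds their partial sums by `∑ δ_k² 𝔼‖H(θ_k, U_k)‖²`. The Lyapunov function enters
only through quadratic growth: `√V` is Lipschitz, so this variance is at most of order
`1 + 𝔼‖θ_k‖²`, which stays bounded by a discrete Grönwall argument, and the whole sum is of the
order of the mesh.
-/

namespace SGLD

theorem le_mul_exp_of_le_add_integral {u : ℝ → ℝ} (hu : Continuous u) {c K T : ℝ} (hK : 0 ≤ K)
    (h : ∀ t ∈ Set.Icc (0 : ℝ) T, u t ≤ c + K * ∫ s in (0 : ℝ)..t, u s) :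
    ∀ t ∈ Set.Icc (0 : ℝ) T, u t ≤ c * Real.exp (K * t) := by
  intro t ht
  have hderiv : ∀ x, HasDerivAt (fun y ↦ ∫ s in (0 : ℝ)..y, u s) (u x) x := fun x ↦
    (hu.integral_hasStrictDerivAt 0 x).hasDerivAt
  have hprimitive : ∫ s in (0 : ℝ)..t, u s ≤ gronwallBound 0 K c (t - 0) :=
    le_gronwallBound_of_liminf_deriv_right_le (f := fun y ↦ ∫ s in (0 : ℝ)..y, u s) (f' := u)
      (fun x _ ↦ (hderiv x).continuousAt.continuousWithinAt)
      (fun x _ _ hr ↦ (hderiv x).hasDerivWithinAt.liminf_right_slope_le hr) (by simp)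
      (fun x hx ↦ (h x ⟨hx.1, hx.2.le⟩).trans_eq (add_comm _ _)) t ht
  calc u t ≤ c + K * ∫ s in (0 : ℝ)..t, u s := h t ht
    _ ≤ c + K * gronwallBound 0 K c (t - 0) := by gcongr
    _ = c * Real.exp (K * t) := by
      rcases hK.eq_or_lt with rfl | hK
      · simp
      · rw [gronwallBound_of_K_ne_0 hK.ne', sub_zero]
        field_simp
        ring

section IntegralEquation

variable {E : Type*} [NormedAddCommGroup E] [NormedSpace ℝ E] {T : ℝ} (hT : 0 ≤ T) {b : E → E}
  {K : ℝ≥0}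

/-- The Picard operator of the integral equation `x t = θ₀ + ∫ s in 0..t, b (x s) + w t` on
`[0, T]`, where the path `w` stands for the noise. -/
noncomputable def picard (hb : Continuous b) (θ₀ : E) (w x : C(Set.Icc (0 : ℝ) T, E)) :
    C(Set.Icc (0 : ℝ) T, E) where
  toFun t := θ₀ + (∫ s in (0 : ℝ)..t, b (x (Set.projIcc 0 T hT s))) + w t
  continuous_toFun := by
    have hc : Continuous fun s ↦ b (x (Set.projIcc 0 T hT s)) := by fun_prop
    have := intervalIntegral.continuous_primitive (μ := volume)
      (fun a b ↦ hc.intervalIntegrable a b) 0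
    fun_prop

theorem picard_apply (hb : Continuous b) (θ₀ : E) (w x : C(Set.Icc (0 : ℝ) T, E))
    (t : Set.Icc (0 : ℝ) T) :
    picard hT hb θ₀ w x t = θ₀ + (∫ s in (0 : ℝ)..t, b (x (Set.projIcc 0 T hT s))) + w t := rfl

variable (hb : LipschitzWith K b)
include hb

theorem norm_picard_sub_picard_le (θ₀ : E) (w w' x y : C(Set.Icc (0 : ℝ) T, E))
    (t : Set.Icc (0 : ℝ) T) :
    ‖picard hT hb.continuous θ₀ w x t - picard hT hb.continuous θ₀ w' y t‖ ≤ dist w w' +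
      K * ∫ s in (0 : ℝ)..t, ‖x (Set.projIcc 0 T hT s) - y (Set.projIcc 0 T hT s)‖ := by
  have hb' := hb.continuous
  have hcont (z : C(Set.Icc (0 : ℝ) T, E)) : Continuous fun s ↦ b (z (Set.projIcc 0 T hT s)) := by
    fun_prop
  have hdist : Continuous fun s ↦
    ‖x (Set.projIcc 0 T hT s) - y (Set.projIcc 0 T hT s)‖ := by fun_prop
  have hsub : picard hT hb.continuous θ₀ w x t - picard hT hb.continuous θ₀ w' y t =
      (w t - w' t) + ∫ s in (0 : ℝ)..t,
        (b (x (Set.projIcc 0 T hT s)) - b (y (Set.projIcc 0 T hT s))) := by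
    rw [intervalIntegral.integral_sub ((hcont x).intervalIntegrable _ _)
      ((hcont y).intervalIntegrable _ _), picard_apply, picard_apply]
    abel
  rw [hsub]
  refine (norm_add_le _ _).trans (add_le_add ?_ ?_)
  · simpa only [dist_eq_norm] using ContinuousMap.dist_apply_le_dist (f := w) (g := w') t
  · rw [← intervalIntegral.integral_const_mul]
    exact intervalIntegral.norm_integral_le_of_norm_le t.2.1
      (ae_of_all _ fun s _ ↦ hb.norm_sub_le _ _) ((hdist.const_mul _).intervalIntegrable _ _)

theorem norm_iterate_picard_sub_le (θ₀ : E) (w x y : C(Set.Icc (0 : ℝ) T, E)) (n : ℕ)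
    (t : Set.Icc (0 : ℝ) T) :
    ‖(picard hT hb.continuous θ₀ w)^[n] x t - (picard hT hb.continuous θ₀ w)^[n] y t‖ ≤
      (K * t) ^ n / n.factorial * dist x y := by
  induction n generalizing t with
  | zero => simpa [dist_eq_norm] using ContinuousMap.dist_apply_le_dist (f := x) (g := y) t
  | succ n ih =>
    rw [Function.iterate_succ_apply', Function.iterate_succ_apply']
    set f := (picard hT hb.continuous θ₀ w)^[n] x
    set g := (picard hT hb.continuous θ₀ w)^[n] y
    have hdist : Continuous fun s ↦
      ‖f (Set.projIcc 0 T hT s) - g (Set.projIcc 0 T hT s)‖ := by fun_prop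
    have hpow : Continuous fun s : ℝ ↦ (K * s) ^ n / n.factorial * dist x y := by fun_prop
    calc ‖picard hT hb.continuous θ₀ w f t - picard hT hb.continuous θ₀ w g t‖
        ≤ K * ∫ s in (0 : ℝ)..t, ‖f (Set.projIcc 0 T hT s) - g (Set.projIcc 0 T hT s)‖ := by
          simpa using norm_picard_sub_picard_le hT hb θ₀ w w f g t
      _ ≤ K * ∫ s in (0 : ℝ)..t, (K * s) ^ n / n.factorial * dist x y := by
          gcongr
          refine intervalIntegral.integral_mono_on t.2.1 (hdist.intervalIntegrable _ _)
            (hpow.intervalIntegrable _ _) fun s hs ↦ ?_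
          have hs' : s ∈ Set.Icc 0 T := ⟨hs.1, hs.2.trans t.2.2⟩
          rw [Set.projIcc_of_mem hT hs']
          exact ih ⟨s, hs'⟩
      _ = (K * t) ^ (n + 1) / (n + 1).factorial * dist x y := by
          simp only [mul_pow, intervalIntegral.integral_mul_const, intervalIntegral.integral_div,
            intervalIntegral.integral_const_mul, integral_pow, Nat.factorial_succ,
            zero_pow n.succ_ne_zero, sub_zero]
          push_cast
          field_simp
          ring

theorem dist_le_of_picard_eq {θ₀ : E} {w w' x y : C(Set.Icc (0 : ℝ) T, E)}
    (hx : picard hT hb.continuous θ₀ w x = x) (hy : picard hT hb.continuous θ₀ w' y = y) :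
    dist x y ≤ Real.exp (K * T) * dist w w' := by
  refine (ContinuousMap.dist_le (by positivity)).2 fun t ↦ ?_
  have hgronwall := le_mul_exp_of_le_add_integral (T := T) (c := dist w w') (K := K)
    (u := fun s ↦ ‖x (Set.projIcc 0 T hT s) - y (Set.projIcc 0 T hT s)‖) (by fun_prop)
    K.coe_nonneg (fun s hs ↦ by
      simpa only [hx, hy, Set.projIcc_of_mem hT hs] using
        norm_picard_sub_picard_le hT hb θ₀ w w' x y ⟨s, hs⟩) t t.2
  simp only [Set.projIcc_val] at hgronwall
  calc dist (x t) (y t) ≤ Real.exp (K * t) * dist w w' := by rwa [dist_eq_norm, mul_comm]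
    _ ≤ Real.exp (K * T) * dist w w' := by gcongr; exact t.2.2

variable [CompleteSpace E]

theorem exists_picard_eq (θ₀ : E) (w : C(Set.Icc (0 : ℝ) T, E)) :
    ∃ x, picard hT hb.continuous θ₀ w x = x := by
  obtain ⟨n, hn⟩ := ((FloorSemiring.tendsto_pow_div_factorial_atTop (K * T : ℝ)).eventually_lt_const
    one_pos).exists
  have hnonneg : 0 ≤ (K * T : ℝ) ^ n / n.factorial := by positivity
  have hcontract : ContractingWith ⟨_, hnonneg⟩ (picard hT hb.continuous θ₀ w)^[n] := by
    refine ⟨by exact_mod_cast hn, LipschitzWith.of_dist_le_mul fun x y ↦ ?_⟩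
    refine (ContinuousMap.dist_le (by positivity)).2 fun t ↦ ?_
    rw [dist_eq_norm]
    refine (norm_iterate_picard_sub_le hT hb θ₀ w x y n t).trans ?_
    have h0 := t.2.1
    have hT' := t.2.2
    change _ ≤ (K * T : ℝ) ^ n / n.factorial * dist x y
    gcongr
  exact ⟨_, hcontract.isFixedPt_fixedPoint_iterate⟩

/-- The Itô map of the equation with Lipschitz drift `b`: it sends a noise path `w` to the
solution `x` of `x t = θ₀ + ∫ s in 0..t, b (x s) + w t` on `[0, T]`. -/
noncomputable def solutionMap (θ₀ : E) (w : C(Set.Icc (0 : ℝ) T, E)) : C(Set.Icc (0 : ℝ) T, E) :=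
  (exists_picard_eq hT hb θ₀ w).choose

theorem picard_solutionMap (θ₀ : E) (w : C(Set.Icc (0 : ℝ) T, E)) :
    picard hT hb.continuous θ₀ w (solutionMap hT hb θ₀ w) = solutionMap hT hb θ₀ w :=
  (exists_picard_eq hT hb θ₀ w).choose_spec

theorem eq_solutionMap_of_picard_eq {θ₀ : E} {w x : C(Set.Icc (0 : ℝ) T, E)}
    (hx : picard hT hb.continuous θ₀ w x = x) : x = solutionMap hT hb θ₀ w := by
  refine dist_le_zero.1 ?_
  simpa using dist_le_of_picard_eq hT hb hx (picard_solutionMap hT hb θ₀ w)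

theorem continuous_solutionMap (θ₀ : E) : Continuous (solutionMap hT hb θ₀) :=
  LipschitzWith.continuous (K := ⟨Real.exp (K * T), (Real.exp_pos _).le⟩) <|
    LipschitzWith.of_dist_le_mul fun w w' ↦
      dist_le_of_picard_eq hT hb (picard_solutionMap hT hb θ₀ w) (picard_solutionMap hT hb θ₀ w')

end IntegralEquation

section ContinuousPath

variable {α E Ω Ω' : Type*} [TopologicalSpace α] [T2Space α] [CompactSpace α]
  [SecondCountableTopology α] [MetricSpace E] [CompleteSpace E] [SecondCountableTopology E]
  [MeasurableSpace E] [BorelSpace E] [MeasurableSpace C(α, E)] [BorelSpace C(α, E)]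
  [MeasurableSpace Ω] [MeasurableSpace Ω']

theorem measurableEmbedding_eval_of_dense {s : Set α} (hs : s.Countable) (hd : Dense s) :
    MeasurableEmbedding fun (x : C(α, E)) (a : s) ↦ x a := by
  have := hs.to_subtype
  refine Continuous.measurableEmbedding (by fun_prop) fun x y hxy ↦ ?_
  exact DFunLike.coe_injective (x.continuous.ext_on hd y.continuous fun a ha ↦
    congrFun hxy ⟨a, ha⟩)

theorem measurable_iff_forall_measurable_eval {X : Ω → C(α, E)} :
    Measurable X ↔ ∀ a, Measurable fun ω ↦ X ω a := by
  obtain ⟨s, hs, hd⟩ := TopologicalSpace.exists_countable_dense α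
  refine ⟨fun h a ↦ (continuous_eval_const a).measurable.comp h, fun h ↦ ?_⟩
  rw [← (measurableEmbedding_eval_of_dense hs hd).measurable_comp_iff]
  exact measurable_pi_lambda _ fun a ↦ h a

theorem identDistrib_of_identDistrib_eval {P : Measure Ω} {P' : Measure Ω'} {X : Ω → C(α, E)}
    {X' : Ω' → C(α, E)} (hX : Measurable X) (hX' : Measurable X')
    (h : IdentDistrib (fun ω a ↦ X ω a) (fun ω a ↦ X' ω a) P P') : IdentDistrib X X' P P' := by
  obtain ⟨s, hs, hd⟩ := TopologicalSpace.exists_countable_dense α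
  have heval := measurableEmbedding_eval_of_dense (E := E) hs hd
  refine ⟨hX.aemeasurable, hX'.aemeasurable, heval.map_injective ?_⟩
  rw [Measure.map_map heval.measurable hX, Measure.map_map heval.measurable hX']
  exact (h.comp (u := fun (x : α → E) (a : s) ↦ x a) (by fun_prop)).map_eq

end ContinuousPath

theorem identDistrib_of_forall_finset_restrict {ι E Ω Ω' : Type*} [MeasurableSpace E]
    [MeasurableSpace Ω] [MeasurableSpace Ω'] {P : Measure Ω} {P' : Measure Ω'} [IsFiniteMeasure P']
    {X : ι → Ω → E} {X' : ι → Ω' → E} (hX : ∀ i, Measurable (X i)) (hX' : ∀ i, Measurable (X' i))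
    (h : ∀ I : Finset ι,
      P.map (fun ω ↦ I.restrict (X · ω)) = P'.map (fun ω ↦ I.restrict (X' · ω))) :
    IdentDistrib (fun ω ↦ (X · ω)) (fun ω ↦ (X' · ω)) P P' := by
  have hXm : AEMeasurable (fun ω ↦ (X · ω)) P := (measurable_pi_lambda _ hX).aemeasurable
  have hXm' : AEMeasurable (fun ω ↦ (X' · ω)) P' := (measurable_pi_lambda _ hX').aemeasurable
  refine ⟨hXm, hXm', ?_⟩
  have hlimit := isProjectiveLimit_map hXm
  simp_rw [h] at hlimit
  exact hlimit.unique (isProjectiveLimit_map hXm')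

namespace IsStandardBM

variable {d : ℕ} {Ω Ω' : Type*} [MeasurableSpace Ω] [MeasurableSpace Ω'] {P : Measure Ω}
  {P' : Measure Ω'} {W : ℝ≥0 → Ω → EuclideanSpace ℝ (Fin d)}
  {W' : ℝ≥0 → Ω' → EuclideanSpace ℝ (Fin d)}

theorem isProbabilityMeasure (hW : IsStandardBM W P) : IsProbabilityMeasure P :=
  hW.indep.isProbabilityMeasure

theorem measurable_coord (hW : IsStandardBM W P) (i : Fin d) (t : ℝ≥0) :
    Measurable fun ω ↦ W t ω i := by
  have := hW.measurable t
  fun_prop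

theorem identDistrib (hW : IsStandardBM W P) (hW' : IsStandardBM W' P') :
    IdentDistrib (fun ω t ↦ W t ω) (fun ω t ↦ W' t ω) P P' := by
  have := hW'.isProbabilityMeasure
  have hcoord (i : Fin d) : IdentDistrib (fun ω t ↦ W t ω i) (fun ω t ↦ W' t ω i) P P' :=
    identDistrib_of_forall_finset_restrict (hW.measurable_coord i) (hW'.measurable_coord i)
      fun I ↦ ((hW.coord i).hasLaw I).map_eq.trans ((hW'.coord i).hasLaw I).map_eq.symm
  exact (IdentDistrib.pi hcoord hW.indep hW'.indep).comp
    (u := fun (y : Fin d → ℝ≥0 → ℝ) (t : ℝ≥0) ↦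
      (WithLp.toLp 2 (fun i ↦ y i t) : EuclideanSpace ℝ (Fin d))) (by fun_prop)

theorem ae_continuous (hW : IsStandardBM W P) : ∀ᵐ ω ∂P, Continuous fun t ↦ W t ω := by
  filter_upwards [ae_all_iff.2 fun i ↦ (hW.coord i).cont] with ω h
  exact (PiLp.continuous_toLp 2 _).comp (continuous_pi h)

theorem exists_measurable_path (hW : IsStandardBM W P) (T : ℝ) :
    ∃ w : Ω → PathSpace d T, Measurable w ∧
      ∀ᵐ ω ∂P, ∀ t : Set.Icc (0 : ℝ) T, w ω t = W (t : ℝ).toNNReal ω := by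
  classical
  obtain ⟨s, hs, hs_meas, hs_null⟩ := exists_measurable_superset_of_null (ae_iff.1 hW.ae_continuous)
  have hcont : ∀ ω ∉ s, Continuous fun t ↦ W t ω := fun ω hω ↦ by_contra fun h ↦ hω (hs h)
  let w : Ω → PathSpace d T := fun ω ↦ if h : ω ∈ s then 0 else
    ⟨fun t ↦ W (t : ℝ).toNNReal ω, (hcont ω h).comp (by fun_prop)⟩
  have hw : ∀ ω t, w ω t = if ω ∈ s then 0 else W (t : ℝ).toNNReal ω := fun ω t ↦ by
    by_cases h : ω ∈ s <;> simp [w, h]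
  refine ⟨w, measurable_iff_forall_measurable_eval.2 fun t ↦ ?_, ?_⟩
  · simp_rw [hw]
    exact Measurable.ite hs_meas measurable_const (hW.measurable _)
  · filter_upwards [compl_mem_ae_iff.2 hs_null] with ω hω t
    rw [hw, if_neg hω]

theorem ae_eq_zero (hW : IsStandardBM W P) : W 0 =ᵐ[P] 0 := by
  filter_upwards [ae_all_iff.2 fun i ↦ (hW.coord i).eval_zero_ae_eq_zero] with ω h
  ext i
  exact h i

theorem memLp_two_coord (hW : IsStandardBM W P) (i : Fin d) (t : ℝ≥0) :
    MemLp (fun ω ↦ W t ω i) 2 P :=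
  ((hW.coord i).hasLaw_eval t).hasGaussianLaw.memLp_two

theorem memLp_two (hW : IsStandardBM W P) (t : ℝ≥0) : MemLp (W t) 2 P :=
  MemLp.of_eval_piLp fun i ↦ hW.memLp_two_coord i t

theorem integral_norm_sq (hW : IsStandardBM W P) (t : ℝ≥0) : ∫ ω, ‖W t ω‖ ^ 2 ∂P = d * t := by
  have := hW.isProbabilityMeasure
  have hcoord : ∀ i, ∫ ω, W t ω i ^ 2 ∂P = t := fun i ↦ by
    have hvar := (hW.coord i).covariance_eval t t
    rw [covariance_self (hW.memLp_two_coord i t).aemeasurable,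
      variance_eq_sub (hW.memLp_two_coord i t), (hW.coord i).integral_eval t] at hvar
    simpa using hvar
  simp_rw [EuclideanSpace.norm_sq_eq, Real.norm_eq_abs, sq_abs]
  rw [integral_finsetSum _ fun i _ ↦ (hW.memLp_two_coord i t).integrable_sq]
  simp [hcoord]

end IsStandardBM

/-- `X` solves `dX_t = b (X_t) dt + dW_t`, `X_0 = θ₀`, on `[0, T]`, driven by the standard
Brownian motion `W`: the Langevin equation with its drift replaced by an arbitrary `b`. -/
structure IsSolution {d : ℕ} {Ω : Type*} [MeasurableSpace Ω]
    (b : EuclideanSpace ℝ (Fin d) → EuclideanSpace ℝ (Fin d)) (θ₀ : EuclideanSpace ℝ (Fin d))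
    {T : ℝ} (hT : 0 ≤ T) (P : Measure Ω) (W : ℝ≥0 → Ω → EuclideanSpace ℝ (Fin d))
    (X : Ω → PathSpace d T) : Prop where
  brownian : IsStandardBM W P
  measurable : Measurable X
  integral_eq : ∀ᵐ ω ∂P, ∀ t : Set.Icc (0 : ℝ) T,
    X ω t = θ₀ + (∫ s in (0 : ℝ)..t, b (X ω (Set.projIcc 0 T hT s))) + W (t : ℝ).toNNReal ω

section Solution

variable {d : ℕ} {Ω Ω' : Type*} [MeasurableSpace Ω] [MeasurableSpace Ω'] {P : Measure Ω}
  {P' : Measure Ω'} {W : ℝ≥0 → Ω → EuclideanSpace ℝ (Fin d)}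
  {W' : ℝ≥0 → Ω' → EuclideanSpace ℝ (Fin d)}
  {b : EuclideanSpace ℝ (Fin d) → EuclideanSpace ℝ (Fin d)} {θ₀ : EuclideanSpace ℝ (Fin d)}
  {T : ℝ} {hT : 0 ≤ T} {X : Ω → PathSpace d T} {X' : Ω' → PathSpace d T} {K : ℝ≥0}

theorem isLangevinDiffusion_iff {π : EuclideanSpace ℝ (Fin d) → ℝ} :
    IsLangevinDiffusion π θ₀ T hT P W X ↔ IsSolution (drift π) θ₀ hT P W X :=
  ⟨fun h ↦ ⟨h.brownian, h.measurable, h.integral_eq⟩,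
    fun h ↦ ⟨h.brownian, h.measurable, h.integral_eq⟩⟩

theorem IsSolution.ae_eq_solutionMap (hX : IsSolution b θ₀ hT P W X) (hb : LipschitzWith K b)
    {w : Ω → PathSpace d T} (hw : ∀ᵐ ω ∂P, ∀ t : Set.Icc (0 : ℝ) T, w ω t = W (t : ℝ).toNNReal ω) :
    X =ᵐ[P] fun ω ↦ solutionMap hT hb θ₀ (w ω) := by
  filter_upwards [hw, hX.integral_eq] with ω hpath hintegral
  refine eq_solutionMap_of_picard_eq hT hb (ContinuousMap.ext fun t ↦ ?_)
  rw [picard_apply, hintegral t, hpath t]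

theorem IsStandardBM.exists_isSolution (hW : IsStandardBM W P) (hb : LipschitzWith K b)
    (θ₀ : EuclideanSpace ℝ (Fin d)) (hT : 0 ≤ T) :
    ∃ X : Ω → PathSpace d T, IsSolution b θ₀ hT P W X := by
  obtain ⟨w, hw_meas, hw⟩ := hW.exists_measurable_path T
  refine ⟨fun ω ↦ solutionMap hT hb θ₀ (w ω), hW,
    (continuous_solutionMap hT hb θ₀).measurable.comp hw_meas, ?_⟩
  filter_upwards [hw] with ω hpath t
  rw [← hpath t, ← picard_apply hT hb.continuous, picard_solutionMap]

theorem IsSolution.identDistrib (hb : LipschitzWith K b)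
    (hX : IsSolution b θ₀ hT P W X) (hX' : IsSolution b θ₀ hT P' W' X') :
    IdentDistrib X X' P P' := by
  obtain ⟨w, hw_meas, hw⟩ := hX.brownian.exists_measurable_path T
  obtain ⟨w', hw_meas', hw'⟩ := hX'.brownian.exists_measurable_path T
  have heval : IdentDistrib (fun ω t ↦ w ω t) (fun ω t ↦ w' ω t) P P' := by
    have hrestrict := (hX.brownian.identDistrib hX'.brownian).comp
      (u := fun (y : ℝ≥0 → EuclideanSpace ℝ (Fin d)) (t : Set.Icc (0 : ℝ) T) ↦
        y (t : ℝ).toNNReal) (by fun_prop)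
    exact ((IdentDistrib.of_ae_eq hrestrict.aemeasurable_fst
      (hw.mono fun ω h ↦ (funext h).symm)).symm.trans hrestrict).trans
      (IdentDistrib.of_ae_eq hrestrict.aemeasurable_snd (hw'.mono fun ω h ↦ (funext h).symm))
  have hsolution := (identDistrib_of_identDistrib_eval hw_meas hw_meas' heval).comp
    (continuous_solutionMap hT hb θ₀).measurable
  exact ((IdentDistrib.of_ae_eq hX.measurable.aemeasurable
    (hX.ae_eq_solutionMap hb hw)).trans hsolution).trans
    (IdentDistrib.of_ae_eq hX'.measurable.aemeasurable (hX'.ae_eq_solutionMap hb hw')).symm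

end Solution

theorem le_mul_exp_sum_of_le_add_sum {v a : ℕ → ℝ} {A : ℝ} {m : ℕ} (hA : 0 ≤ A)
    (ha : ∀ j < m, 0 ≤ a j) (h : ∀ k ≤ m, v k ≤ A + ∑ j ∈ Finset.range k, a j * v j) :
    ∀ k ≤ m, v k ≤ A * Real.exp (∑ j ∈ Finset.range k, a j) := by
  suffices hsum : ∀ k ≤ m, A + ∑ j ∈ Finset.range k, a j * v j ≤
      A * Real.exp (∑ j ∈ Finset.range k, a j) from fun k hk ↦ (h k hk).trans (hsum k hk)
  intro k
  induction k with
  | zero => simp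
  | succ k ih =>
    intro hk
    have hak := ha k hk
    calc A + ∑ j ∈ Finset.range (k + 1), a j * v j
        = A + ∑ j ∈ Finset.range k, a j * v j + a k * v k := by
          rw [Finset.sum_range_succ, add_assoc]
      _ ≤ (1 + a k) * (A + ∑ j ∈ Finset.range k, a j * v j) := by
          have := mul_le_mul_of_nonneg_left (h k (by omega)) hak
          linarith
      _ ≤ (1 + a k) * (A * Real.exp (∑ j ∈ Finset.range k, a j)) := by
          gcongr
          exact ih (by omega)
      _ ≤ Real.exp (a k) * (A * Real.exp (∑ j ∈ Finset.range k, a j)) := by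
          gcongr
          rw [add_comm]
          exact Real.add_one_le_exp _
      _ = A * Real.exp (∑ j ∈ Finset.range (k + 1), a j) := by
          rw [Finset.sum_range_succ, Real.exp_add]
          ring

section TimeGrid

variable {δ : ℕ → ℝ} {m k : ℕ} {T : ℝ}

theorem time_zero (δ : ℕ → ℝ) : time δ 0 = 0 := Finset.sum_range_zero _

theorem time_succ (δ : ℕ → ℝ) (k : ℕ) : time δ (k + 1) = time δ k + δ k :=
  Finset.sum_range_succ _ _

theorem time_mem_Icc (hδ : ∀ k < m, 0 < δ k) (hsum : time δ m = T) (hk : k ≤ m) :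
    time δ k ∈ Set.Icc 0 T :=
  ⟨time_zero δ ▸ time_mono hδ k.zero_le hk, hsum ▸ time_mono hδ hk le_rfl⟩

theorem le_mesh (hk : k < m) : δ k ≤ mesh δ m :=
  le_ciSup (f := fun j : Fin m ↦ δ j) (Set.finite_range _).bddAbove ⟨k, hk⟩

theorem exists_mem_Icc_time (hm : 0 < m) {t : ℝ} (ht : t ∈ Set.Icc 0 (time δ m)) :
    ∃ k < m, t ∈ Set.Icc (time δ k) (time δ (k + 1)) := by
  induction m, hm using Nat.le_induction with
  | base => exact ⟨0, one_pos, by simpa only [time_zero] using ht⟩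
  | succ m _ ih =>
    rcases le_total t (time δ m) with h | h
    · obtain ⟨k, hk, hkt⟩ := ih ⟨ht.1, h⟩
      exact ⟨k, by omega, hkt⟩
    · exact ⟨m, by omega, h, ht.2⟩

theorem exists_interpolation_mem_segment {d : ℕ} (hδ : ∀ k < m, 0 < δ k) (hsum : time δ m = T)
    (hm : 0 < m) (θ : ℕ → EuclideanSpace ℝ (Fin d)) (t : Set.Icc (0 : ℝ) T) :
    ∃ k < m, (t : ℝ) ∈ Set.Icc (time δ k) (time δ (k + 1)) ∧
      interpolation T δ m θ t ∈ segment ℝ (θ k) (θ (k + 1)) := by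
  obtain ⟨k, hk, hkt⟩ := exists_mem_Icc_time hm (by rw [hsum]; exact t.2)
  refine ⟨k, hk, hkt, ?_⟩
  rw [← segment_eq_Icc (hkt.1.trans hkt.2), segment_eq_image₂] at hkt
  obtain ⟨⟨x, y⟩, ⟨hx, hy, hxy⟩, hcomb⟩ := hkt
  obtain rfl : y = 1 - x := by linarith
  simp only [smul_eq_mul] at hcomb
  have hval := interpolation_apply (T := T) θ hδ hk ⟨hx, by linarith⟩ (by rw [hcomb]; exact t.2)
  simp only [hcomb] at hval
  rw [hval]
  exact ⟨x, 1 - x, hx, hy, hxy, rfl⟩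

theorem measurable_interpolation {d : ℕ} {Ω : Type*} [MeasurableSpace Ω] (T : ℝ) (δ : ℕ → ℝ)
    (m : ℕ) {θ : ℕ → Ω → EuclideanSpace ℝ (Fin d)} (hθ : ∀ k, Measurable (θ k)) :
    Measurable fun ω ↦ interpolation T δ m fun k ↦ θ k ω := by
  refine measurable_iff_forall_measurable_eval.2 fun t ↦ ?_
  exact (hθ 0).add (Finset.measurable_fun_sum _ fun k _ ↦
    ((hθ (k + 1)).sub (hθ k)).const_smul (max 0 (min 1 (((t : ℝ) - time δ k) / δ k))))

end TimeGrid

section Euler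

variable {E : Type*} [NormedAddCommGroup E] [NormedSpace ℝ E] {T : ℝ} {hT : 0 ≤ T} {b : E → E}
  {K : ℝ≥0} {θ₀ : E} {w x : C(Set.Icc (0 : ℝ) T, E)} {δ : ℕ → ℝ} {m : ℕ} {M θ : ℕ → E} {μ o : ℝ}

/-- `θ` is an Euler scheme with step-sizes `δ` for the equation
`x t = θ₀ + ∫ s in 0..t, b (x s) + w t` on `[0, T]`, up to the accumulated errors `M`. -/
def IsPerturbedEuler (hT : 0 ≤ T) (b : E → E) (θ₀ : E) (w : C(Set.Icc (0 : ℝ) T, E)) (δ : ℕ → ℝ)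
    (m : ℕ) (M θ : ℕ → E) : Prop :=
  ∀ k ≤ m, θ k = θ₀ + ∑ j ∈ Finset.range k, δ j • b (θ j) + M k +
    w (Set.projIcc 0 T hT (time δ k))

theorem IsPerturbedEuler.sub_eq_sum (hθ : IsPerturbedEuler hT b θ₀ w δ m M θ) (hb : Continuous b)
    (hx : picard hT hb θ₀ w x = x) (hδ : ∀ k < m, 0 < δ k) (hsum : time δ m = T) {k : ℕ}
    (hk : k ≤ m) :
    θ k - x (Set.projIcc 0 T hT (time δ k)) = ∑ j ∈ Finset.range k,
      (δ j • b (θ j) - ∫ s in time δ j..time δ (j + 1), b (x (Set.projIcc 0 T hT s))) + M k := by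
  have hcont : Continuous fun u ↦ b (x (Set.projIcc 0 T hT u)) := by fun_prop
  have hsplit := intervalIntegral.sum_integral_adjacent_intervals (a := time δ) (n := k)
    (μ := volume) fun j _ ↦ hcont.intervalIntegrable _ _
  have hxk := picard_apply hT hb θ₀ w x (Set.projIcc 0 T hT (time δ k))
  rw [time_zero] at hsplit
  rw [hx, Set.projIcc_of_mem hT (time_mem_Icc hδ hsum hk), ← hsplit] at hxk
  rw [hθ k hk, Set.projIcc_of_mem hT (time_mem_Icc hδ hsum hk), hxk, Finset.sum_sub_distrib]
  abel

variable [CompleteSpace E]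

theorem norm_smul_sub_integral_le (hb : LipschitzWith K b) {s t : ℝ} (hst : s ≤ t)
    (ho : ∀ u ∈ Set.Icc s t, dist (x (Set.projIcc 0 T hT s)) (x (Set.projIcc 0 T hT u)) ≤ o)
    (y : E) :
    ‖(t - s) • b y - ∫ u in s..t, b (x (Set.projIcc 0 T hT u))‖ ≤
      K * (t - s) * (‖y - x (Set.projIcc 0 T hT s)‖ + o) := by
  have hcont : Continuous fun u ↦ b (x (Set.projIcc 0 T hT u)) := by
    have := hb.continuous
    fun_prop
  rw [← intervalIntegral.integral_const, ← intervalIntegral.integral_sub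
    (by simp) (hcont.intervalIntegrable _ _)]
  refine (intervalIntegral.norm_integral_le_of_norm_le_const
    (C := K * (‖y - x (Set.projIcc 0 T hT s)‖ + o)) fun u hu ↦ ?_).trans_eq ?_
  · rw [Set.uIoc_of_le hst] at hu
    refine (hb.norm_sub_le _ _).trans ?_
    gcongr
    refine (norm_sub_le_norm_sub_add_norm_sub _ (x (Set.projIcc 0 T hT s)) _).trans ?_
    gcongr
    simpa only [dist_eq_norm] using ho u ⟨hu.1.le, hu.2⟩
  · rw [abs_of_nonneg (sub_nonneg.2 hst)]
    ring

theorem norm_smul_sub_integral_time_le (hb : LipschitzWith K b) (hδ : ∀ k < m, 0 < δ k)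
    (hsum : time δ m = T)
    (ho : ∀ s t : Set.Icc (0 : ℝ) T, dist s t ≤ mesh δ m → dist (x s) (x t) ≤ o)
    {j : ℕ} (hj : j < m) (y : E) :
    ‖δ j • b y - ∫ s in time δ j..time δ (j + 1), b (x (Set.projIcc 0 T hT s))‖ ≤
      K * δ j * (‖y - x (Set.projIcc 0 T hT (time δ j))‖ + o) := by
  have hδj : time δ (j + 1) - time δ j = δ j := by rw [time_succ]; ring
  have hle : time δ j ≤ time δ (j + 1) := by linarith [hδ j hj]
  rw [← hδj]
  refine norm_smul_sub_integral_le hb hle (fun u hu ↦ ho _ _ ?_) y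
  have hjT := time_mem_Icc hδ hsum hj.le
  have hjT' := time_mem_Icc hδ hsum (Nat.succ_le_of_lt hj)
  rw [Set.projIcc_of_mem hT hjT,
    Set.projIcc_of_mem hT ⟨hjT.1.trans hu.1, hu.2.trans hjT'.2⟩, Subtype.dist_eq, dist_comm,
    Real.dist_eq, abs_of_nonneg (sub_nonneg.2 hu.1)]
  linarith [hu.2, le_mesh (δ := δ) hj]

theorem IsPerturbedEuler.norm_sub_le (hθ : IsPerturbedEuler hT b θ₀ w δ m M θ)
    (hb : LipschitzWith K b) (hx : picard hT hb.continuous θ₀ w x = x) (hδ : ∀ k < m, 0 < δ k)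
    (hsum : time δ m = T) (hM : ∀ k ≤ m, ‖M k‖ ≤ μ)
    (ho : ∀ s t : Set.Icc (0 : ℝ) T, dist s t ≤ mesh δ m → dist (x s) (x t) ≤ o) (ho0 : 0 ≤ o)
    {k : ℕ} (hk : k ≤ m) :
    ‖θ k - x (Set.projIcc 0 T hT (time δ k))‖ ≤ (μ + K * T * o) * Real.exp (K * T) := by
  have hμ0 : 0 ≤ μ := (norm_nonneg _).trans (hM 0 m.zero_le)
  have hKtime : ∀ k, ∑ j ∈ Finset.range k, K * δ j = K * time δ k := fun k ↦
    (Finset.mul_sum _ _ _).symm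
  have htime : K * time δ k ≤ K * T := by gcongr; exact (time_mem_Icc hδ hsum hk).2
  refine (le_mul_exp_sum_of_le_add_sum (a := fun j ↦ K * δ j) (A := μ + K * T * o)
    (v := fun k ↦ ‖θ k - x (Set.projIcc 0 T hT (time δ k))‖) (by positivity)
    (fun j hj ↦ mul_nonneg K.coe_nonneg (hδ j hj).le) (fun k hk ↦ ?_) k hk).trans
    (by rw [hKtime]; gcongr)
  calc ‖θ k - x (Set.projIcc 0 T hT (time δ k))‖
      ≤ ∑ j ∈ Finset.range k, K * δ j * (‖θ j - x (Set.projIcc 0 T hT (time δ j))‖ + o) + μ := by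
        rw [hθ.sub_eq_sum hb.continuous hx hδ hsum hk]
        refine (norm_add_le _ _).trans (add_le_add ?_ (hM k hk))
        exact norm_sum_le_of_le _ fun j hj ↦ norm_smul_sub_integral_time_le hb hδ hsum ho
          ((Finset.mem_range.1 hj).trans_le hk) (θ j)
    _ = μ + K * time δ k * o + ∑ j ∈ Finset.range k,
          K * δ j * ‖θ j - x (Set.projIcc 0 T hT (time δ j))‖ := by
        simp only [mul_add, Finset.sum_add_distrib, ← Finset.sum_mul, hKtime]
        ring
    _ ≤ μ + K * T * o + ∑ j ∈ Finset.range k,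
          K * δ j * ‖θ j - x (Set.projIcc 0 T hT (time δ j))‖ := by
        gcongr
        exact (time_mem_Icc hδ hsum hk).2

end Euler

section Interpolation

variable {d : ℕ} {T : ℝ} {b : EuclideanSpace ℝ (Fin d) → EuclideanSpace ℝ (Fin d)} {K : ℝ≥0}
  {θ₀ : EuclideanSpace ℝ (Fin d)} {w x : PathSpace d T}

theorem IsPerturbedEuler.dist_interpolation_le (hT : 0 < T) {δ : ℕ → ℝ} {m : ℕ}
    {M θ : ℕ → EuclideanSpace ℝ (Fin d)} {μ o : ℝ}
    (hθ : IsPerturbedEuler hT.le b θ₀ w δ m M θ)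
    (hb : LipschitzWith K b) (hx : picard hT.le hb.continuous θ₀ w x = x) (hδ : ∀ k < m, 0 < δ k)
    (hsum : time δ m = T) (hM : ∀ k ≤ m, ‖M k‖ ≤ μ)
    (ho : ∀ s t : Set.Icc (0 : ℝ) T, dist s t ≤ mesh δ m → dist (x s) (x t) ≤ o) (ho0 : 0 ≤ o) :
    dist (interpolation T δ m θ) x ≤ (μ + K * T * o) * Real.exp (K * T) + o := by
  have hμ0 : 0 ≤ μ := (norm_nonneg _).trans (hM 0 m.zero_le)
  have hm : 0 < m := Nat.pos_of_ne_zero <| by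
    rintro rfl
    exact hT.ne (time_zero δ ▸ hsum)
  refine (ContinuousMap.dist_le (by positivity)).2 fun t ↦ ?_
  obtain ⟨k, hk, hkt, hsegment⟩ := exists_interpolation_mem_segment hδ hsum hm θ t
  have hstep : time δ (k + 1) - time δ k ≤ mesh δ m := by
    rw [time_succ, add_sub_cancel_left]
    exact le_mesh hk
  have hgrid : ∀ j ≤ m, |time δ j - t| ≤ mesh δ m →
      θ j ∈ Metric.closedBall (x t) ((μ + K * T * o) * Real.exp (K * T) + o) := fun j hj hjt ↦ by
    have herror := hθ.norm_sub_le hb hx hδ hsum hM ho ho0 hj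
    rw [Set.projIcc_of_mem hT.le (time_mem_Icc hδ hsum hj), ← dist_eq_norm] at herror
    exact (dist_triangle _ (x ⟨time δ j, time_mem_Icc hδ hsum hj⟩) _).trans
      (add_le_add herror (ho _ _ hjt))
  refine (convex_closedBall _ _).segment_subset (hgrid k hk.le ?_) (hgrid (k + 1) hk ?_) hsegment
  all_goals
    rw [abs_le]
    constructor <;> linarith [hkt.1, hkt.2]

theorem tendsto_interpolation_of_isPerturbedEuler {ι : Type*} {l : Filter ι} (hT : 0 < T)
    {δ : ι → ℕ → ℝ} {m : ι → ℕ} {M θ : ι → ℕ → EuclideanSpace ℝ (Fin d)} {μ : ι → ℝ}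
    (hθ : ∀ i, IsPerturbedEuler hT.le b θ₀ w (δ i) (m i) (M i) (θ i))
    (hb : LipschitzWith K b) (hx : picard hT.le hb.continuous θ₀ w x = x)
    (hδ : ∀ i, ∀ k < m i, 0 < δ i k) (hsum : ∀ i, time (δ i) (m i) = T)
    (hmesh : Tendsto (fun i ↦ mesh (δ i) (m i)) l (𝓝 0)) (hM : ∀ i, ∀ k ≤ m i, ‖M i k‖ ≤ μ i)
    (hμ : Tendsto μ l (𝓝 0)) :
    Tendsto (fun i ↦ interpolation T (δ i) (m i) (θ i)) l (𝓝 x) := by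
  rw [Metric.tendsto_nhds]
  intro ε hε
  set f : ℝ × ℝ → ℝ := fun p ↦ (p.1 + K * T * p.2) * Real.exp (K * T) + p.2
  have hf : Tendsto f (𝓝 (0, 0)) (𝓝 0) := by
    have : Continuous f := by fun_prop
    simpa [f] using this.tendsto (0, 0)
  obtain ⟨ρ, hρ, hfρ⟩ := Metric.eventually_nhds_iff.1 (hf.eventually_lt_const hε)
  obtain ⟨η, hη, hosc⟩ := Metric.uniformContinuous_iff.1
    (CompactSpace.uniformContinuous_of_continuous x.continuous) (ρ / 2) (by positivity)
  filter_upwards [hmesh.eventually_lt_const hη, Metric.tendsto_nhds.1 hμ ρ hρ]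
    with i hmesh_lt hμ_lt
  refine ((hθ i).dist_interpolation_le hT (o := ρ / 2) hb hx (hδ i) (hsum i) (hM i)
    (fun s t hst ↦ (hosc (hst.trans_lt hmesh_lt)).le) (by positivity)).trans_lt
    (hfρ (y := (μ i, ρ / 2)) ?_)
  rw [Prod.dist_eq, max_lt_iff]
  exact ⟨hμ_lt, by simp only [Real.dist_0_eq_abs, abs_of_pos (half_pos hρ), half_lt_self hρ]⟩

end Interpolation

section Freezing

variable {S 𝒰 E Ω : Type*} {𝓖 mΩ : MeasurableSpace Ω} [MeasurableSpace S] [MeasurableSpace 𝒰]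
  {P : Measure Ω} [IsProbabilityMeasure P] {X : Ω → S} {U : Ω → 𝒰}

theorem lintegral_comp_of_indepFun (hX : Measurable X) (hU : Measurable U) (hXU : IndepFun X U P)
    {F : S → 𝒰 → ℝ≥0∞} (hF : Measurable (Function.uncurry F)) :
    ∫⁻ ω, F (X ω) (U ω) ∂P = ∫⁻ ω, ∫⁻ u, F (X ω) u ∂P.map U ∂P := by
  have := Measure.isProbabilityMeasure_map (μ := P) hU.aemeasurable
  have hlaw := (indepFun_iff_map_prod_eq_prod_map_map hX.aemeasurable hU.aemeasurable).1 hXU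
  calc ∫⁻ ω, F (X ω) (U ω) ∂P
      = ∫⁻ y, Function.uncurry F y ∂P.map fun ω ↦ (X ω, U ω) :=
        (lintegral_map hF (hX.prodMk hU)).symm
    _ = ∫⁻ x, ∫⁻ u, F x u ∂P.map U ∂P.map X := by
        rw [hlaw, lintegral_prod _ hF.aemeasurable]
        rfl
    _ = ∫⁻ ω, ∫⁻ u, F (X ω) u ∂P.map U ∂P := lintegral_map hF.lintegral_prod_right hX

variable [NormedAddCommGroup E] [NormedSpace ℝ E]

theorem integral_comp_of_indepFun (hX : Measurable X) (hU : Measurable U) (hXU : IndepFun X U P)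
    {F : S → 𝒰 → E} (hF : StronglyMeasurable (Function.uncurry F))
    (hFint : Integrable (fun ω ↦ F (X ω) (U ω)) P) :
    ∫ ω, F (X ω) (U ω) ∂P = ∫ ω, ∫ u, F (X ω) u ∂P.map U ∂P := by
  have := Measure.isProbabilityMeasure_map (μ := P) hU.aemeasurable
  have hpair : AEMeasurable (fun ω ↦ (X ω, U ω)) P := (hX.prodMk hU).aemeasurable
  have hlaw := (indepFun_iff_map_prod_eq_prod_map_map hX.aemeasurable hU.aemeasurable).1 hXU
  have hFint' := (integrable_map_measure (f := fun ω ↦ (X ω, U ω)) (g := Function.uncurry F)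
    hF.aestronglyMeasurable hpair).2 hFint
  calc ∫ ω, F (X ω) (U ω) ∂P
      = ∫ y, Function.uncurry F y ∂P.map fun ω ↦ (X ω, U ω) :=
        (integral_map hpair hF.aestronglyMeasurable).symm
    _ = ∫ x, ∫ u, F x u ∂P.map U ∂P.map X := by
        rw [hlaw, integral_prod _ (hlaw ▸ hFint')]
        rfl
    _ = ∫ ω, ∫ u, F (X ω) u ∂P.map U ∂P :=
        integral_map hX.aemeasurable hF.integral_prod_right.aestronglyMeasurable

theorem condExp_comp_eq_zero_of_indep [CompleteSpace E] (h𝓖 : 𝓖 ≤ mΩ)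
    (hX : Measurable[𝓖] X) (hU : Measurable U)
    (hindep : Indep 𝓖 (MeasurableSpace.comap U inferInstance) P) {F : S → 𝒰 → E}
    (hF : StronglyMeasurable (Function.uncurry F)) (hFint : Integrable (fun ω ↦ F (X ω) (U ω)) P)
    (hF0 : ∀ x, ∫ u, F x u ∂P.map U = 0) : P[fun ω ↦ F (X ω) (U ω) | 𝓖] =ᵐ[P] 0 := by
  refine (ae_eq_condExp_of_forall_setIntegral_eq h𝓖 hFint (fun _ _ _ ↦ integrableOn_zero)
    (fun A hA _ ↦ ?_) aestronglyMeasurable_zero).symm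
  -- `A` becomes a function of the frozen variable once its indicator is adjoined to `X`.
  let Y : Ω → S × ℝ := fun ω ↦ (X ω, A.indicator (fun _ ↦ 1) ω)
  have hY : Measurable[𝓖] Y := hX.prodMk ((measurable_indicator_const_iff 1).2 hA)
  have hYU : IndepFun Y U P := indep_of_indep_of_le_left hindep hY.comap_le
  have hindicator : (fun ω ↦ (Y ω).2 • F (Y ω).1 (U ω)) =
      A.indicator fun ω ↦ F (X ω) (U ω) := by
    ext ω
    by_cases hω : ω ∈ A <;> simp [Y, hω]
  have hzero := integral_comp_of_indepFun (F := fun y u ↦ y.2 • F y.1 u) (hY.mono h𝓖 le_rfl) hU hYU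
    (measurable_snd.comp measurable_fst |>.stronglyMeasurable.smul
      (hF.comp_measurable (by fun_prop : Measurable fun y : (S × ℝ) × 𝒰 ↦ (y.1.1, y.2))))
    (hindicator ▸ hFint.indicator (h𝓖 A hA))
  simp only [integral_smul, hF0, smul_zero, integral_zero] at hzero
  rw [← integral_indicator (h𝓖 A hA) (f := fun ω ↦ F (X ω) (U ω)), ← hindicator, hzero]
  simp only [integral_zero]

end Freezing

section MartingaleDifferences

variable {E Ω : Type*} {mΩ : MeasurableSpace Ω} {P : Measure Ω} [IsFiniteMeasure P]
  [NormedAddCommGroup E]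

theorem submartingale_norm_sq [NormedSpace ℝ E] [CompleteSpace E] {𝓕 : Filtration ℕ mΩ}
    {M : ℕ → Ω → E} (hM : Martingale M 𝓕 P) (hM2 : ∀ k, MemLp (M k) 2 P) :
    Submartingale (fun k ω ↦ ‖M k ω‖ ^ 2) 𝓕 P := by
  have hint k := (hM2 k).integrable_norm_pow two_ne_zero
  refine submartingale_nat (fun k ↦ (hM.stronglyMeasurable k).norm.pow 2) hint fun k ↦ ?_
  have hconvex : ConvexOn ℝ Set.univ fun x : E ↦ ‖x‖ ^ 2 :=
    convexOn_univ_norm.pow (fun _ _ ↦ norm_nonneg _) 2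
  have hjensen := hconvex.map_condExp_le_univ (𝓕.le k)
    (by fun_prop : Continuous fun x : E ↦ ‖x‖ ^ 2).lowerSemicontinuous
    (hM.integrable (k + 1)) (hint (k + 1))
  filter_upwards [hM.condExp_ae_eq k.le_succ, hjensen] with ω hcond hle
  rwa [Function.comp_apply, hcond] at hle

theorem measure_exists_le_norm_le {𝓕 : Filtration ℕ mΩ} {M : ℕ → Ω → E}
    (hM : Submartingale (fun k ω ↦ ‖M k ω‖ ^ 2) 𝓕 P) (n : ℕ) {ε : ℝ} (hε : 0 < ε) :
    P {ω | ∃ k ≤ n, ε ≤ ‖M k ω‖} ≤ ENNReal.ofReal ((∫ ω, ‖M n ω‖ ^ 2 ∂P) / ε ^ 2) := by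
  have hdoob := maximal_ineq hM (fun k ω ↦ sq_nonneg ‖M k ω‖) (ε := (ε ^ 2).toNNReal) n
  have hset : {ω | ε ^ 2 ≤ (Finset.range (n + 1)).sup' Finset.nonempty_range_add_one
      fun k ↦ ‖M k ω‖ ^ 2} = {ω | ∃ k ≤ n, ε ≤ ‖M k ω‖} := by
    ext ω
    simp only [Set.mem_ofPred_eq, Finset.le_sup'_iff, Finset.mem_range, Nat.lt_succ_iff,
      pow_le_pow_iff_left₀ hε.le (norm_nonneg _) two_ne_zero]
  rw [Real.coe_toNNReal _ (sq_nonneg ε), hset] at hdoob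
  have hmono := setIntegral_le_integral (s := {ω | ∃ k ≤ n, ε ≤ ‖M k ω‖}) (hM.integrable n)
    (ae_of_all _ fun ω ↦ sq_nonneg ‖M n ω‖)
  rw [ENNReal.ofReal_div_of_pos (by positivity), ENNReal.le_div_iff_mul_le
    (.inl (ENNReal.ofReal_pos.2 (by positivity)).ne') (.inl ENNReal.ofReal_ne_top), mul_comm]
  exact hdoob.trans (ENNReal.ofReal_le_ofReal hmono)

variable {𝓕 : Filtration ℕ mΩ} {Y : ℕ → Ω → E}

theorem stronglyMeasurable_sum_range (hadapted : ∀ k, StronglyMeasurable[𝓕 (k + 1)] (Y k))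
    (n : ℕ) : StronglyMeasurable[𝓕 n] fun ω ↦ ∑ k ∈ Finset.range n, Y k ω :=
  Finset.stronglyMeasurable_fun_sum _ fun k hk ↦
    (hadapted k).mono (𝓕.mono (Finset.mem_range.1 hk))

variable [InnerProductSpace ℝ E] [CompleteSpace E]

theorem integral_norm_add_sq_of_condExp_eq_zero {𝓖 : MeasurableSpace Ω} (h𝓖 : 𝓖 ≤ mΩ)
    {X Y : Ω → E} (hX : StronglyMeasurable[𝓖] X) (hX2 : MemLp X 2 P) (hY2 : MemLp Y 2 P)
    (hY : P[Y | 𝓖] =ᵐ[P] 0) :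
    ∫ ω, ‖X ω + Y ω‖ ^ 2 ∂P = ∫ ω, ‖X ω‖ ^ 2 ∂P + ∫ ω, ‖Y ω‖ ^ 2 ∂P := by
  have hinner : Integrable (fun ω ↦ inner ℝ (X ω) (Y ω)) P :=
    (hX2.norm.integrable_mul hY2.norm).mono' (hX2.1.inner hY2.1)
      (ae_of_all _ fun ω ↦ norm_inner_le_norm _ _)
  have horthogonal : ∫ ω, inner ℝ (X ω) (Y ω) ∂P = 0 := by
    rw [← integral_condExp h𝓖]
    refine integral_eq_zero_of_ae ?_
    filter_upwards [condExp_bilin_of_stronglyMeasurable_left (innerSL ℝ) hX hinner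
      (hY2.integrable one_le_two), hY] with ω hpull hzero
    rw [hzero] at hpull
    exact hpull.trans (map_zero _)
  have hXint := hX2.integrable_norm_pow two_ne_zero
  have hYint := hY2.integrable_norm_pow two_ne_zero
  have hsum : Integrable (fun ω ↦ ‖X ω‖ ^ 2 + ‖Y ω‖ ^ 2) P := hXint.add hYint
  calc ∫ ω, ‖X ω + Y ω‖ ^ 2 ∂P
      = ∫ ω, (‖X ω‖ ^ 2 + ‖Y ω‖ ^ 2 + 2 * inner ℝ (X ω) (Y ω)) ∂P :=
        integral_congr_ae <| ae_of_all _ fun ω ↦ by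
          simp only [norm_add_sq_real]
          ring
    _ = ∫ ω, ‖X ω‖ ^ 2 ∂P + ∫ ω, ‖Y ω‖ ^ 2 ∂P := by
        rw [integral_add hsum (hinner.const_mul 2), integral_const_mul, horthogonal,
          mul_zero, add_zero, integral_add hXint hYint]

theorem integral_norm_sum_sq_of_condExp_eq_zero
    (hadapted : ∀ k, StronglyMeasurable[𝓕 (k + 1)] (Y k)) (hY2 : ∀ k, MemLp (Y k) 2 P)
    (hY : ∀ k, P[Y k | 𝓕 k] =ᵐ[P] 0) (n : ℕ) :
    ∫ ω, ‖∑ k ∈ Finset.range n, Y k ω‖ ^ 2 ∂P = ∑ k ∈ Finset.range n, ∫ ω, ‖Y k ω‖ ^ 2 ∂P := by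
  induction n with
  | zero => simp
  | succ n ih =>
    simp_rw [Finset.sum_range_succ]
    rw [integral_norm_add_sq_of_condExp_eq_zero (𝓕.le n) (stronglyMeasurable_sum_range hadapted n)
      (memLp_finsetSum _ fun k _ ↦ hY2 k) (hY2 n) (hY n), ih]

theorem measure_exists_le_norm_sum_le (hadapted : ∀ k, StronglyMeasurable[𝓕 (k + 1)] (Y k))
    (hY2 : ∀ k, MemLp (Y k) 2 P) (hY : ∀ k, P[Y k | 𝓕 k] =ᵐ[P] 0) (n : ℕ) {ε : ℝ} (hε : 0 < ε) :
    P {ω | ∃ k ≤ n, ε ≤ ‖∑ j ∈ Finset.range k, Y j ω‖} ≤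
      ENNReal.ofReal ((∑ k ∈ Finset.range n, ∫ ω, ‖Y k ω‖ ^ 2 ∂P) / ε ^ 2) := by
  have hsum2 (n : ℕ) : MemLp (fun ω ↦ ∑ k ∈ Finset.range n, Y k ω) 2 P :=
    memLp_finsetSum _ fun k _ ↦ hY2 k
  have hmartingale : Martingale (fun n ω ↦ ∑ k ∈ Finset.range n, Y k ω) 𝓕 P := by
    refine martingale_of_condExp_sub_eq_zero_nat (stronglyMeasurable_sum_range hadapted)
      (fun n ↦ (hsum2 n).integrable one_le_two) fun n ↦ ?_
    convert hY n using 2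
    ext ω
    simp only [Pi.sub_apply, Finset.sum_range_succ, add_sub_cancel_left]
  rw [← integral_norm_sum_sq_of_condExp_eq_zero hadapted hY2 hY n]
  exact measure_exists_le_norm_le (submartingale_norm_sq hmartingale hsum2) n hε

end MartingaleDifferences

section PastFiltration

variable {Ω : Type*} {mΩ : MeasurableSpace Ω} {P : Measure Ω}

theorem indepFun_prodMk_of_prodMk {α β γ : Type*} [MeasurableSpace α] [MeasurableSpace β]
    [MeasurableSpace γ] [IsProbabilityMeasure P] {X : Ω → α} {Y : Ω → β} {Z : Ω → γ}
    (hX : Measurable X) (hY : Measurable Y) (hZ : Measurable Z) (hXY : IndepFun X Y P)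
    (hXYZ : IndepFun (fun ω ↦ (X ω, Y ω)) Z P) : IndepFun X (fun ω ↦ (Y ω, Z ω)) P := by
  have := Measure.isProbabilityMeasure_map (μ := P) hX.aemeasurable
  have := Measure.isProbabilityMeasure_map (μ := P) hY.aemeasurable
  have := Measure.isProbabilityMeasure_map (μ := P) hZ.aemeasurable
  have hYZ : IndepFun Y Z P := hXYZ.comp measurable_snd measurable_id
  rw [indepFun_iff_map_prod_eq_prod_map_map hX.aemeasurable (hY.prodMk hZ).aemeasurable,
    (indepFun_iff_map_prod_eq_prod_map_map hY.aemeasurable hZ.aemeasurable).1 hYZ,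
    ← Measure.prodAssoc_prod,
    ← (indepFun_iff_map_prod_eq_prod_map_map hX.aemeasurable hY.aemeasurable).1 hXY,
    ← (indepFun_iff_map_prod_eq_prod_map_map (hX.prodMk hY).aemeasurable hZ.aemeasurable).1 hXYZ,
    Measure.map_map (by fun_prop) ((hX.prodMk hY).prodMk hZ)]
  rfl

variable {α 𝒰 : Type*} [MeasurableSpace α] [MeasurableSpace 𝒰] {Z : Ω → α} {U : ℕ → Ω → 𝒰}

/-- The filtration whose `k`-th σ-algebra is generated by `Z` and by `U j`, `j < k`. Applied to a
Brownian motion `Z`, its initial σ-algebra knows the whole path of `Z`. -/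
def pastFiltration (hZ : Measurable Z) (hU : ∀ k, Measurable (U k)) : Filtration ℕ mΩ where
  seq k := MeasurableSpace.comap (fun ω ↦ (fun j : Finset.range k ↦ U j ω, Z ω)) inferInstance
  mono' i j hij := by
    have hrestrict : Measurable fun y : (Finset.range j → 𝒰) × α ↦
        (fun l : Finset.range i ↦ y.1 ⟨l, Finset.range_mono hij l.2⟩, y.2) := by fun_prop
    exact (hrestrict.comp (comap_measurable fun ω ↦
      (fun l : Finset.range j ↦ U l ω, Z ω))).comap_le
  le' k := Measurable.comap_le (by fun_prop)

variable (hZ : Measurable Z) (hU : ∀ k, Measurable (U k))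

theorem measurable_pastFiltration_base (k : ℕ) : Measurable[pastFiltration hZ hU k] Z :=
  measurable_snd.comp (comap_measurable _)

theorem measurable_pastFiltration {j k : ℕ} (hjk : j < k) :
    Measurable[pastFiltration hZ hU k] (U j) := by
  have heval : Measurable fun y : (Finset.range k → 𝒰) × α ↦
    y.1 ⟨j, Finset.mem_range.2 hjk⟩ := by fun_prop
  exact heval.comp (comap_measurable fun ω ↦ (fun j : Finset.range k ↦ U j ω, Z ω))

theorem indep_pastFiltration (hindep : iIndepFun U P) (hUZ : IndepFun (fun ω k ↦ U k ω) Z P)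
    (k : ℕ) : Indep (pastFiltration hZ hU k) (MeasurableSpace.comap (U k) inferInstance) P := by
  have := hindep.isProbabilityMeasure
  have hpast : IndepFun (U k) (fun ω (j : Finset.range k) ↦ U j ω) P :=
    (hindep.indepFun_finset {k} (Finset.range k) (by simp) hU).comp
      (φ := fun y : ({k} : Finset ℕ) → 𝒰 ↦ y ⟨k, Finset.mem_singleton_self k⟩) (by fun_prop)
      measurable_id
  have hbase : IndepFun (fun ω ↦ (U k ω, fun j : Finset.range k ↦ U j ω)) Z P :=
    hUZ.comp (φ := fun y ↦ (y k, fun j : Finset.range k ↦ y j)) (by fun_prop) measurable_id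
  exact (indepFun_prodMk_of_prodMk (hU k) (by fun_prop) hZ hpast hbase).symm

end PastFiltration

section SquareIntegrable

variable {E F : Type*} [NormedAddCommGroup E] [NormedAddCommGroup F]

theorem norm_sq_le_of_lipschitzWith {b : E → F} {K : ℝ≥0} (hb : LipschitzWith K b) (x : E) :
    ‖b x‖ ^ 2 ≤ 2 * (‖b 0‖ ^ 2 + K ^ 2) * (1 + ‖x‖ ^ 2) := by
  have hlinear : ‖b x‖ ≤ ‖b 0‖ + K * ‖x‖ := by
    have hdiff := hb.norm_sub_le x 0
    rw [sub_zero] at hdiff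
    linarith [norm_sub_norm_le (b x) (b 0)]
  calc ‖b x‖ ^ 2
      ≤ (‖b 0‖ + K * ‖x‖) ^ 2 := by gcongr
    _ ≤ 2 * (‖b 0‖ ^ 2 + (K * ‖x‖) ^ 2) := add_sq_le
    _ ≤ 2 * (‖b 0‖ ^ 2 + K ^ 2) * (1 + ‖x‖ ^ 2) := by
        nlinarith [mul_nonneg (sq_nonneg ‖b 0‖) (sq_nonneg ‖x‖), sq_nonneg (K : ℝ)]

theorem norm_add₄_sq_le (x y z w : E) :
    ‖x + y + z + w‖ ^ 2 ≤ 4 * (‖x‖ ^ 2 + ‖y‖ ^ 2 + ‖z‖ ^ 2 + ‖w‖ ^ 2) := by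
  calc ‖x + y + z + w‖ ^ 2
      ≤ ((‖x‖ + ‖y‖) + (‖z‖ + ‖w‖)) ^ 2 := by
        gcongr
        rw [← add_assoc]
        exact norm_add₄_le
    _ ≤ 2 * ((‖x‖ + ‖y‖) ^ 2 + (‖z‖ + ‖w‖) ^ 2) := add_sq_le
    _ ≤ 2 * (2 * (‖x‖ ^ 2 + ‖y‖ ^ 2) + 2 * (‖z‖ ^ 2 + ‖w‖ ^ 2)) := by
        gcongr <;> exact add_sq_le
    _ = 4 * (‖x‖ ^ 2 + ‖y‖ ^ 2 + ‖z‖ ^ 2 + ‖w‖ ^ 2) := by ring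

theorem norm_sum_smul_sq_le [NormedSpace ℝ E] {ι : Type*} (s : Finset ι) {a : ι → ℝ}
    (ha : ∀ i ∈ s, 0 ≤ a i) (x : ι → E) :
    ‖∑ i ∈ s, a i • x i‖ ^ 2 ≤ (∑ i ∈ s, a i) * ∑ i ∈ s, a i * ‖x i‖ ^ 2 := by
  calc ‖∑ i ∈ s, a i • x i‖ ^ 2
      ≤ (∑ i ∈ s, a i * ‖x i‖) ^ 2 := by
        gcongr
        refine norm_sum_le_of_le s fun i hi ↦ ?_
        rw [norm_smul, Real.norm_of_nonneg (ha i hi)]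
    _ ≤ (∑ i ∈ s, a i) * ∑ i ∈ s, a i * ‖x i‖ ^ 2 :=
        Finset.sum_sq_le_sum_mul_sum_of_sq_le_mul s ha
          (fun i hi ↦ mul_nonneg (ha i hi) (sq_nonneg _)) fun i _ ↦ le_of_eq (by ring)

variable {Ω : Type*} [MeasurableSpace Ω] {P : Measure Ω}

theorem memLp_comp_lipschitzWith [IsFiniteMeasure P] {b : E → F} {K : ℝ≥0} (hb : LipschitzWith K b)
    {p : ℝ≥0∞} {θ : Ω → E} (hθ : MemLp θ p P) : MemLp (fun ω ↦ b (θ ω)) p P := by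
  have hcentred : MemLp (fun ω ↦ b (θ ω) - b 0) p P :=
    (LipschitzWith.of_dist_le_mul (f := fun x ↦ b x - b 0) (K := K) fun x y ↦ by
      simpa only [dist_sub_right] using hb.dist_le_mul x y).comp_memLp (sub_self _) hθ
  exact (hcentred.add (memLp_const (b 0))).ae_eq (ae_of_all _ fun ω ↦ sub_add_cancel _ _)

theorem integral_norm_sq_comp_le_of_lipschitzWith [IsProbabilityMeasure P] {b : E → F} {K : ℝ≥0}
    (hb : LipschitzWith K b) {θ : Ω → E} (hθ : MemLp θ 2 P) :
    ∫ ω, ‖b (θ ω)‖ ^ 2 ∂P ≤ 2 * (‖b 0‖ ^ 2 + K ^ 2) * (1 + ∫ ω, ‖θ ω‖ ^ 2 ∂P) := by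
  have hθ_sq := hθ.integrable_norm_pow two_ne_zero
  have hone_add : Integrable (fun ω ↦ 1 + ‖θ ω‖ ^ 2) P := (integrable_const 1).add hθ_sq
  calc ∫ ω, ‖b (θ ω)‖ ^ 2 ∂P
      ≤ ∫ ω, 2 * (‖b 0‖ ^ 2 + K ^ 2) * (1 + ‖θ ω‖ ^ 2) ∂P :=
        integral_mono ((memLp_comp_lipschitzWith hb hθ).integrable_norm_pow two_ne_zero)
          (hone_add.const_mul _) fun ω ↦ norm_sq_le_of_lipschitzWith hb (θ ω)
    _ = 2 * (‖b 0‖ ^ 2 + K ^ 2) * (1 + ∫ ω, ‖θ ω‖ ^ 2 ∂P) := by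
        rw [integral_const_mul, integral_add (integrable_const 1) hθ_sq]
        simp

theorem memLp_two_of_lintegral_enorm_sq_ne_top {f : Ω → E} (hf : AEStronglyMeasurable f P)
    (h : ∫⁻ ω, ‖f ω‖ₑ ^ 2 ∂P ≠ ∞) : MemLp f 2 P := by
  refine ⟨hf, ?_⟩
  rw [eLpNorm_lt_top_iff_lintegral_rpow_enorm_lt_top (by simp) (by simp)]
  simpa using h.lt_top

theorem ofReal_integral_norm_sq {f : Ω → E} (hf : MemLp f 2 P) :
    ENNReal.ofReal (∫ ω, ‖f ω‖ ^ 2 ∂P) = ∫⁻ ω, ‖f ω‖ₑ ^ 2 ∂P := by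
  rw [ofReal_integral_eq_lintegral_ofReal (hf.integrable_norm_pow two_ne_zero)
    (ae_of_all _ fun ω ↦ by positivity)]
  simp only [ENNReal.ofReal_pow (norm_nonneg _), ofReal_norm]

end SquareIntegrable

section StochasticGradient

variable {d : ℕ} {𝒰 Ω : Type*}
  {b : EuclideanSpace ℝ (Fin d) → EuclideanSpace ℝ (Fin d)}
  {G : EuclideanSpace ℝ (Fin d) → 𝒰 → EuclideanSpace ℝ (Fin d)}
  {θ₀ : EuclideanSpace ℝ (Fin d)} {δ : ℕ → ℝ} {m : ℕ} {T : ℝ} {U : ℕ → Ω → 𝒰}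
  {W : ℝ≥0 → Ω → EuclideanSpace ℝ (Fin d)}

/-- The error made by `½ G(θ, u)` as an estimate of the drift `b θ`; it is `½ H(θ, u)` when
`b = ½ ∇ log π`. -/
noncomputable def driftError (b : EuclideanSpace ℝ (Fin d) → EuclideanSpace ℝ (Fin d))
    (G : EuclideanSpace ℝ (Fin d) → 𝒰 → EuclideanSpace ℝ (Fin d)) (θ : EuclideanSpace ℝ (Fin d))
    (u : 𝒰) : EuclideanSpace ℝ (Fin d) :=
  (1 / 2 : ℝ) • G θ u - b θ

/-- The SGLD chain as a random process. -/
noncomputable def sgld (G : EuclideanSpace ℝ (Fin d) → 𝒰 → EuclideanSpace ℝ (Fin d))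
    (θ₀ : EuclideanSpace ℝ (Fin d)) (δ : ℕ → ℝ) (U : ℕ → Ω → 𝒰)
    (W : ℝ≥0 → Ω → EuclideanSpace ℝ (Fin d)) (k : ℕ) (ω : Ω) : EuclideanSpace ℝ (Fin d) :=
  chain G θ₀ δ (fun j ↦ U j ω) (noise (fun t ↦ W t ω) δ) k

/-- The contribution of the gradient error to the `k`-th step of the SGLD chain. -/
noncomputable def stepError (b : EuclideanSpace ℝ (Fin d) → EuclideanSpace ℝ (Fin d))
    (G : EuclideanSpace ℝ (Fin d) → 𝒰 → EuclideanSpace ℝ (Fin d))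
    (θ₀ : EuclideanSpace ℝ (Fin d)) (δ : ℕ → ℝ) (U : ℕ → Ω → 𝒰)
    (W : ℝ≥0 → Ω → EuclideanSpace ℝ (Fin d)) (k : ℕ) (ω : Ω) : EuclideanSpace ℝ (Fin d) :=
  δ k • driftError b G (sgld G θ₀ δ U W k ω) (U k ω)

theorem sgld_succ (b : EuclideanSpace ℝ (Fin d) → EuclideanSpace ℝ (Fin d)) (k : ℕ) (ω : Ω) :
    sgld G θ₀ δ U W (k + 1) ω = sgld G θ₀ δ U W k ω + δ k • b (sgld G θ₀ δ U W k ω) +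
      stepError b G θ₀ δ U W k ω + √(δ k) • noise (fun t ↦ W t ω) δ k := by
  rw [sgld, chain, ← sgld, stepError, driftError]
  module

theorem sqrt_smul_noise (w : ℝ≥0 → EuclideanSpace ℝ (Fin d)) {k : ℕ} (hk : 0 < δ k) :
    √(δ k) • noise w δ k = w (time δ (k + 1)).toNNReal - w (time δ k).toNNReal := by
  rw [noise, smul_smul, mul_inv_cancel₀ (Real.sqrt_pos.2 hk).ne', one_smul]

theorem sgld_eq_add_sum (b : EuclideanSpace ℝ (Fin d) → EuclideanSpace ℝ (Fin d))
    (hδ : ∀ k < m, 0 < δ k) {k : ℕ} (hk : k ≤ m) (ω : Ω) :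
    sgld G θ₀ δ U W k ω = θ₀ + ∑ j ∈ Finset.range k, δ j • b (sgld G θ₀ δ U W j ω) +
      ∑ j ∈ Finset.range k, stepError b G θ₀ δ U W j ω +
      (W (time δ k).toNNReal ω - W 0 ω) := by
  induction k with
  | zero => simp [sgld, chain, time_zero]
  | succ k ih =>
    rw [sgld_succ b, sqrt_smul_noise _ (hδ k hk), Finset.sum_range_succ, Finset.sum_range_succ]
    nth_rw 1 [ih (by omega)]
    abel

theorem isPerturbedEuler_sgld (b : EuclideanSpace ℝ (Fin d) → EuclideanSpace ℝ (Fin d))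
    (hT : 0 ≤ T) (hδ : ∀ k < m, 0 < δ k) (hsum : time δ m = T) {ω : Ω} {w : PathSpace d T}
    (hw : ∀ t : Set.Icc (0 : ℝ) T, w t = W (t : ℝ).toNNReal ω) (hW0 : W 0 ω = 0) :
    IsPerturbedEuler hT b θ₀ w δ m (fun k ↦ ∑ j ∈ Finset.range k, stepError b G θ₀ δ U W j ω)
      fun k ↦ sgld G θ₀ δ U W k ω := fun k hk ↦ by
  beta_reduce
  rw [sgld_eq_add_sum b hδ hk, hw, Set.projIcc_of_mem hT (time_mem_Icc hδ hsum hk), hW0, sub_zero]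

variable [MeasurableSpace 𝒰] {ν : Measure 𝒰} {C : ℝ≥0}

/-- `½ G` is an unbiased estimate of `b` whose variance grows at most quadratically. The variance
bound makes the errors integrable, so `integral_error` is not about a junk value. -/
structure IsDriftEstimate (b : EuclideanSpace ℝ (Fin d) → EuclideanSpace ℝ (Fin d))
    (G : EuclideanSpace ℝ (Fin d) → 𝒰 → EuclideanSpace ℝ (Fin d)) (ν : Measure 𝒰) (C : ℝ≥0) :
    Prop where
  measurable : Measurable (Function.uncurry G)
  integral_error : ∀ θ, ∫ u, driftError b G θ u ∂ν = 0
  lintegral_error_sq_le : ∀ θ, ∫⁻ u, ‖driftError b G θ u‖ₑ ^ 2 ∂ν ≤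
    ENNReal.ofReal (C * (1 + ‖θ‖ ^ 2))

theorem IsDriftEstimate.measurable_driftError (hG : IsDriftEstimate b G ν C) (hb : Measurable b) :
    Measurable (Function.uncurry (driftError b G)) :=
  (hG.measurable.const_smul (1 / 2 : ℝ)).sub (hb.comp measurable_fst)

theorem IsDriftEstimate.lintegral_driftError_comp_le [MeasurableSpace Ω] {P : Measure Ω}
    [IsProbabilityMeasure P] {ξ : Ω → 𝒰} (hG : IsDriftEstimate b G (P.map ξ) C) (hb : Measurable b)
    {θ : Ω → EuclideanSpace ℝ (Fin d)} (hθ : Measurable θ) (hθ2 : MemLp θ 2 P)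
    (hξ : Measurable ξ) (hindep : IndepFun θ ξ P) :
    ∫⁻ ω, ‖driftError b G (θ ω) (ξ ω)‖ₑ ^ 2 ∂P ≤
      ENNReal.ofReal (C * (1 + ∫ ω, ‖θ ω‖ ^ 2 ∂P)) := by
  have hmeas := hG.measurable_driftError hb
  have hint := hθ2.integrable_norm_pow two_ne_zero
  have hbound : Integrable (fun ω ↦ C * (1 + ‖θ ω‖ ^ 2)) P :=
    ((integrable_const 1).add hint).const_mul _
  rw [lintegral_comp_of_indepFun hθ hξ hindep (F := fun x u ↦ ‖driftError b G x u‖ₑ ^ 2)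
    (hmeas.enorm.pow_const 2)]
  calc ∫⁻ ω, ∫⁻ u, ‖driftError b G (θ ω) u‖ₑ ^ 2 ∂P.map ξ ∂P
      ≤ ∫⁻ ω, ENNReal.ofReal (C * (1 + ‖θ ω‖ ^ 2)) ∂P :=
        lintegral_mono fun ω ↦ hG.lintegral_error_sq_le (θ ω)
    _ = ENNReal.ofReal (∫ ω, C * (1 + ‖θ ω‖ ^ 2) ∂P) :=
        (ofReal_integral_eq_lintegral_ofReal hbound (ae_of_all _ fun ω ↦ by positivity)).symm
    _ = ENNReal.ofReal (C * (1 + ∫ ω, ‖θ ω‖ ^ 2 ∂P)) := by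
        rw [integral_const_mul, integral_add (integrable_const 1) hint]
        simp

theorem measurable_noise {_ : MeasurableSpace Ω} (hW : ∀ t, Measurable (W t)) (δ : ℕ → ℝ) (k : ℕ) :
    Measurable fun ω ↦ noise (fun t ↦ W t ω) δ k :=
  ((hW (time δ (k + 1)).toNNReal).sub (hW (time δ k).toNNReal)).const_smul (√(δ k))⁻¹

theorem measurable_sgld {_ : MeasurableSpace Ω} (hG : Measurable (Function.uncurry G))
    (hW : ∀ t, Measurable (W t)) {k : ℕ} (hU : ∀ j < k, Measurable (U j)) :
    Measurable (sgld G θ₀ δ U W k) := by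
  induction k with
  | zero => exact measurable_const
  | succ k ih =>
    have hprev := ih fun j hj ↦ hU j (by omega)
    have hgrad : Measurable fun ω ↦ G (sgld G θ₀ δ U W k ω) (U k ω) :=
      hG.comp (hprev.prodMk (hU k (by omega)))
    exact (hprev.add (hgrad.const_smul (1 / 2 * δ k))).add
      ((measurable_noise hW δ k).const_smul √(δ k))

end StochasticGradient

section DrivingNoise

variable {d : ℕ} {𝒰 Ω : Type*} [MeasurableSpace 𝒰] {mΩ : MeasurableSpace Ω} {P : Measure Ω}
  {b : EuclideanSpace ℝ (Fin d) → EuclideanSpace ℝ (Fin d)}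
  {G : EuclideanSpace ℝ (Fin d) → 𝒰 → EuclideanSpace ℝ (Fin d)} {ν : Measure 𝒰} {C K : ℝ≥0}
  {θ₀ : EuclideanSpace ℝ (Fin d)} {δ : ℕ → ℝ} {U : ℕ → Ω → 𝒰}
  {W : ℝ≥0 → Ω → EuclideanSpace ℝ (Fin d)}

/-- `W` is a standard Brownian motion and the auxiliary variables `U` of one SGLD chain are
independent of each other and of `W`, with law `ν`. -/
structure IsDrivingNoise (U : ℕ → Ω → 𝒰) (W : ℝ≥0 → Ω → EuclideanSpace ℝ (Fin d))
    (ν : Measure 𝒰) (P : Measure Ω) : Prop where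
  brownian : IsStandardBM W P
  measurable : ∀ k, Measurable (U k)
  map_eq : ∀ k, P.map (U k) = ν
  indep : iIndepFun U P
  indep_brownian : IndepFun (fun ω k ↦ U k ω) (fun ω t ↦ W t ω) P

namespace IsDrivingNoise

theorem measurable_brownian (hU : IsDrivingNoise U W ν P) : Measurable fun ω t ↦ W t ω :=
  measurable_pi_lambda _ hU.brownian.measurable

/-- The history of the SGLD chain, together with the whole path of the Brownian motion. -/
def filtration (hU : IsDrivingNoise U W ν P) : Filtration ℕ mΩ :=
  pastFiltration hU.measurable_brownian hU.measurable

theorem measurable_sgld_filtration (hU : IsDrivingNoise U W ν P)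
    (hG : Measurable (Function.uncurry G)) (k : ℕ) :
    Measurable[hU.filtration k] (sgld G θ₀ δ U W k) :=
  measurable_sgld hG
    (fun t ↦ (measurable_pi_apply t).comp
      (measurable_pastFiltration_base hU.measurable_brownian hU.measurable k))
    fun _ hj ↦ measurable_pastFiltration hU.measurable_brownian hU.measurable hj

theorem stronglyMeasurable_stepError (hU : IsDrivingNoise U W ν P) (hG : IsDriftEstimate b G ν C)
    (hb : Measurable b) (k : ℕ) :
    StronglyMeasurable[hU.filtration (k + 1)] (stepError b G θ₀ δ U W k) := by
  have hθ : Measurable[hU.filtration (k + 1)] (sgld G θ₀ δ U W k) :=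
    (hU.measurable_sgld_filtration hG.measurable k).mono (hU.filtration.mono k.le_succ) le_rfl
  have hUk : Measurable[hU.filtration (k + 1)] (U k) :=
    measurable_pastFiltration hU.measurable_brownian hU.measurable k.lt_succ_self
  exact (((hG.measurable_driftError hb).comp (hθ.prodMk hUk)).const_smul (δ k)).stronglyMeasurable

variable [IsProbabilityMeasure P]

theorem lintegral_driftError_sgld_le (hU : IsDrivingNoise U W ν P) (hG : IsDriftEstimate b G ν C)
    (hb : Measurable b) {k : ℕ} (hθ2 : MemLp (sgld G θ₀ δ U W k) 2 P) :
    ∫⁻ ω, ‖driftError b G (sgld G θ₀ δ U W k ω) (U k ω)‖ₑ ^ 2 ∂P ≤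
      ENNReal.ofReal (C * (1 + ∫ ω, ‖sgld G θ₀ δ U W k ω‖ ^ 2 ∂P)) := by
  have hθ := hU.measurable_sgld_filtration (θ₀ := θ₀) (δ := δ) hG.measurable k
  have hindep := indep_pastFiltration hU.measurable_brownian hU.measurable hU.indep
    hU.indep_brownian k
  exact IsDriftEstimate.lintegral_driftError_comp_le (ξ := U k) (by rwa [hU.map_eq k]) hb
    (hθ.mono (hU.filtration.le k) le_rfl) hθ2 (hU.measurable k)
    (indep_of_indep_of_le_left hindep hθ.comap_le)

theorem memLp_stepError_of_memLp_sgld (hU : IsDrivingNoise U W ν P) (hG : IsDriftEstimate b G ν C)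
    (hb : Measurable b) {k : ℕ} (hθ2 : MemLp (sgld G θ₀ δ U W k) 2 P) :
    MemLp (stepError b G θ₀ δ U W k) 2 P := by
  have hmeas : Measurable fun ω ↦ driftError b G (sgld G θ₀ δ U W k ω) (U k ω) :=
    (hG.measurable_driftError hb).comp
      (((hU.measurable_sgld_filtration hG.measurable k).mono (hU.filtration.le k) le_rfl).prodMk
        (hU.measurable k))
  exact (memLp_two_of_lintegral_enorm_sq_ne_top hmeas.aestronglyMeasurable
    ((hU.lintegral_driftError_sgld_le hG hb hθ2).trans_lt ENNReal.ofReal_lt_top).ne).const_smul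
      (δ k)

theorem memLp_sgld (hU : IsDrivingNoise U W ν P) (hG : IsDriftEstimate b G ν C)
    (hb : LipschitzWith K b) (k : ℕ) : MemLp (sgld G θ₀ δ U W k) 2 P := by
  induction k with
  | zero => exact memLp_const θ₀
  | succ k ih =>
    have hnoise : MemLp (fun ω ↦ noise (fun t ↦ W t ω) δ k) 2 P :=
      ((hU.brownian.memLp_two _).sub (hU.brownian.memLp_two _)).const_smul (√(δ k))⁻¹
    exact (((ih.add ((memLp_comp_lipschitzWith hb ih).const_smul (δ k))).add
      (hU.memLp_stepError_of_memLp_sgld hG hb.continuous.measurable ih)).add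
      (hnoise.const_smul √(δ k))).ae_eq (ae_of_all _ fun ω ↦ (sgld_succ b k ω).symm)

theorem memLp_stepError (hU : IsDrivingNoise U W ν P) (hG : IsDriftEstimate b G ν C)
    (hb : LipschitzWith K b) (k : ℕ) : MemLp (stepError b G θ₀ δ U W k) 2 P :=
  hU.memLp_stepError_of_memLp_sgld hG hb.continuous.measurable (hU.memLp_sgld hG hb k)

theorem integral_norm_sq_stepError_le (hU : IsDrivingNoise U W ν P) (hG : IsDriftEstimate b G ν C)
    (hb : LipschitzWith K b) (k : ℕ) :
    ∫ ω, ‖stepError b G θ₀ δ U W k ω‖ ^ 2 ∂P ≤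
      δ k ^ 2 * (C * (1 + ∫ ω, ‖sgld G θ₀ δ U W k ω‖ ^ 2 ∂P)) := by
  have : 0 ≤ ∫ ω, ‖sgld G θ₀ δ U W k ω‖ ^ 2 ∂P := integral_nonneg fun _ ↦ sq_nonneg _
  rw [← ENNReal.ofReal_le_ofReal_iff (by positivity),
    ofReal_integral_norm_sq (hU.memLp_stepError hG hb k), ENNReal.ofReal_mul (sq_nonneg _)]
  simp only [stepError, enorm_smul, mul_pow]
  rw [lintegral_const_mul' _ _ (by simp), Real.enorm_eq_ofReal_abs,
    ← ENNReal.ofReal_pow (abs_nonneg _), sq_abs]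
  gcongr
  exact hU.lintegral_driftError_sgld_le hG hb.continuous.measurable (hU.memLp_sgld hG hb k)

theorem condExp_stepError (hU : IsDrivingNoise U W ν P) (hG : IsDriftEstimate b G ν C)
    (hb : LipschitzWith K b) (k : ℕ) : P[stepError b G θ₀ δ U W k | hU.filtration k] =ᵐ[P] 0 := by
  have hmeas := hG.measurable_driftError hb.continuous.measurable
  refine condExp_comp_eq_zero_of_indep (F := fun x u ↦ δ k • driftError b G x u)
    (hU.filtration.le k) (hU.measurable_sgld_filtration hG.measurable k) (hU.measurable k)
    (indep_pastFiltration hU.measurable_brownian hU.measurable hU.indep hU.indep_brownian k)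
    (hmeas.const_smul (δ k)).stronglyMeasurable
    ((hU.memLp_stepError hG hb k).integrable one_le_two) fun x ↦ ?_
  rw [hU.map_eq, integral_smul, hG.integral_error, smul_zero]

end IsDrivingNoise

end DrivingNoise

theorem IsPerturbedEuler.norm_sq_le {E : Type*} [NormedAddCommGroup E] [NormedSpace ℝ E] {T : ℝ}
    {hT : 0 ≤ T} {b : E → E} {θ₀ : E} {w : C(Set.Icc (0 : ℝ) T, E)} {δ : ℕ → ℝ} {m : ℕ}
    {M θ : ℕ → E} (hθ : IsPerturbedEuler hT b θ₀ w δ m M θ) (hδ : ∀ k < m, 0 < δ k)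
    (hsum : time δ m = T) {k : ℕ} (hk : k ≤ m) :
    ‖θ k‖ ^ 2 ≤ 4 * (‖θ₀‖ ^ 2 + T * ∑ j ∈ Finset.range k, δ j * ‖b (θ j)‖ ^ 2 + ‖M k‖ ^ 2 +
      ‖w (Set.projIcc 0 T hT (time δ k))‖ ^ 2) := by
  have hδ0 : ∀ j ∈ Finset.range k, 0 ≤ δ j := fun j hj ↦
    (hδ j ((Finset.mem_range.1 hj).trans_le hk)).le
  rw [hθ k hk]
  refine (norm_add₄_sq_le _ _ _ _).trans ?_
  gcongr
  refine (norm_sum_smul_sq_le _ hδ0 _).trans ?_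
  gcongr
  · exact Finset.sum_nonneg fun j hj ↦ mul_nonneg (hδ0 j hj) (sq_nonneg _)
  · exact (time_mem_Icc hδ hsum hk).2

section Moments

variable {d : ℕ} {𝒰 Ω : Type*} [MeasurableSpace 𝒰] {mΩ : MeasurableSpace Ω} {P : Measure Ω}
  [IsProbabilityMeasure P] {b : EuclideanSpace ℝ (Fin d) → EuclideanSpace ℝ (Fin d)}
  {G : EuclideanSpace ℝ (Fin d) → 𝒰 → EuclideanSpace ℝ (Fin d)} {ν : Measure 𝒰} {C K : ℝ≥0}
  {θ₀ : EuclideanSpace ℝ (Fin d)} {T : ℝ} {δ : ℕ → ℝ} {m : ℕ} {U : ℕ → Ω → 𝒰}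
  {W : ℝ≥0 → Ω → EuclideanSpace ℝ (Fin d)}

/-- The rate at which Grönwall's inequality lets the second moments of the SGLD chain grow. -/
noncomputable def momentRate (b : EuclideanSpace ℝ (Fin d) → EuclideanSpace ℝ (Fin d))
    (K C : ℝ≥0) (T : ℝ) : ℝ :=
  4 * T * (2 * (‖b 0‖ ^ 2 + K ^ 2) + C)

/-- The bound on `1 + 𝔼‖θ_k‖²` that Grönwall's inequality provides, uniformly over the chains. -/
noncomputable def momentBound (b : EuclideanSpace ℝ (Fin d) → EuclideanSpace ℝ (Fin d))
    (K C : ℝ≥0) (θ₀ : EuclideanSpace ℝ (Fin d)) (T : ℝ) : ℝ :=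
  (1 + 4 * ‖θ₀‖ ^ 2 + 4 * (d * T)) * Real.exp (momentRate b K C T * T)

namespace IsDrivingNoise

theorem integral_norm_sum_stepError_sq_le (hU : IsDrivingNoise U W ν P)
    (hG : IsDriftEstimate b G ν C) (hb : LipschitzWith K b) (k : ℕ) :
    ∫ ω, ‖∑ j ∈ Finset.range k, stepError b G θ₀ δ U W j ω‖ ^ 2 ∂P ≤
      ∑ j ∈ Finset.range k, δ j ^ 2 * (C * (1 + ∫ ω, ‖sgld G θ₀ δ U W j ω‖ ^ 2 ∂P)) := by
  rw [integral_norm_sum_sq_of_condExp_eq_zero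
    (hU.stronglyMeasurable_stepError hG hb.continuous.measurable) (hU.memLp_stepError hG hb)
    (hU.condExp_stepError hG hb)]
  exact Finset.sum_le_sum fun j _ ↦ hU.integral_norm_sq_stepError_le hG hb j

theorem integral_norm_sq_sgld_le (hU : IsDrivingNoise U W ν P) (hG : IsDriftEstimate b G ν C)
    (hb : LipschitzWith K b) (hT : 0 ≤ T) (hδ : ∀ k < m, 0 < δ k) (hsum : time δ m = T) {k : ℕ}
    (hk : k ≤ m) :
    ∫ ω, ‖sgld G θ₀ δ U W k ω‖ ^ 2 ∂P ≤
      4 * (‖θ₀‖ ^ 2 + T * ∑ j ∈ Finset.range k, δ j * ∫ ω, ‖b (sgld G θ₀ δ U W j ω)‖ ^ 2 ∂P +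
        ∫ ω, ‖∑ j ∈ Finset.range k, stepError b G θ₀ δ U W j ω‖ ^ 2 ∂P + d * time δ k) := by
  obtain ⟨w, -, hw⟩ := hU.brownian.exists_measurable_path T
  have hdrift (j : ℕ) : Integrable (fun ω ↦ δ j * ‖b (sgld G θ₀ δ U W j ω)‖ ^ 2) P :=
    ((memLp_comp_lipschitzWith hb (hU.memLp_sgld hG hb j)).integrable_norm_pow
      two_ne_zero).const_mul (δ j)
  have herror : Integrable
      (fun ω ↦ ‖∑ j ∈ Finset.range k, stepError b G θ₀ δ U W j ω‖ ^ 2) P :=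
    (memLp_finsetSum _ fun j _ ↦ hU.memLp_stepError hG hb j).integrable_norm_pow two_ne_zero
  have hbrownian := (hU.brownian.memLp_two (time δ k).toNNReal).integrable_norm_pow two_ne_zero
  have hdriftSum : Integrable (fun ω ↦ T * ∑ j ∈ Finset.range k,
      δ j * ‖b (sgld G θ₀ δ U W j ω)‖ ^ 2) P :=
    (integrable_finsetSum _ fun j _ ↦ hdrift j).const_mul T
  have hconst_drift : Integrable (fun ω ↦ ‖θ₀‖ ^ 2 + T * ∑ j ∈ Finset.range k,
      δ j * ‖b (sgld G θ₀ δ U W j ω)‖ ^ 2) P := (integrable_const _).add hdriftSum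
  have hno_brownian : Integrable (fun ω ↦ ‖θ₀‖ ^ 2 + T * ∑ j ∈ Finset.range k,
      δ j * ‖b (sgld G θ₀ δ U W j ω)‖ ^ 2 +
      ‖∑ j ∈ Finset.range k, stepError b G θ₀ δ U W j ω‖ ^ 2) P := hconst_drift.add herror
  calc ∫ ω, ‖sgld G θ₀ δ U W k ω‖ ^ 2 ∂P
      ≤ ∫ ω, 4 * (‖θ₀‖ ^ 2 + T * ∑ j ∈ Finset.range k, δ j * ‖b (sgld G θ₀ δ U W j ω)‖ ^ 2 +
          ‖∑ j ∈ Finset.range k, stepError b G θ₀ δ U W j ω‖ ^ 2 +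
          ‖W (time δ k).toNNReal ω‖ ^ 2) ∂P := by
        refine integral_mono_ae ((hU.memLp_sgld hG hb k).integrable_norm_pow two_ne_zero)
          ((hno_brownian.add hbrownian).const_mul 4) ?_
        filter_upwards [hw, hU.brownian.ae_eq_zero] with ω hpath hzero
        have hle := (isPerturbedEuler_sgld (G := G) (θ₀ := θ₀) (U := U) b hT hδ hsum hpath
          hzero).norm_sq_le hδ hsum hk
        rwa [hpath, Set.projIcc_of_mem hT (time_mem_Icc hδ hsum hk)] at hle
    _ = _ := by
        rw [integral_const_mul, integral_add hno_brownian hbrownian,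
          integral_add hconst_drift herror, integral_add (integrable_const _) hdriftSum,
          integral_const_mul, integral_finsetSum _ fun j _ ↦ hdrift j, hU.brownian.integral_norm_sq,
          Real.coe_toNNReal _ (time_mem_Icc hδ hsum hk).1]
        simp only [integral_const, integral_const_mul, probReal_univ, one_smul]

theorem one_add_integral_norm_sq_sgld_le_add_sum (hU : IsDrivingNoise U W ν P)
    (hG : IsDriftEstimate b G ν C) (hb : LipschitzWith K b) (hT : 0 ≤ T) (hδ : ∀ k < m, 0 < δ k)
    (hsum : time δ m = T) {k : ℕ} (hk : k ≤ m) :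
    1 + ∫ ω, ‖sgld G θ₀ δ U W k ω‖ ^ 2 ∂P ≤ (1 + 4 * ‖θ₀‖ ^ 2 + 4 * (d * T)) +
      ∑ j ∈ Finset.range k, momentRate b K C T * δ j *
        (1 + ∫ ω, ‖sgld G θ₀ δ U W j ω‖ ^ 2 ∂P) := by
  set L : ℝ := 2 * (‖b 0‖ ^ 2 + K ^ 2) with hL
  set v : ℕ → ℝ := fun j ↦ 1 + ∫ ω, ‖sgld G θ₀ δ U W j ω‖ ^ 2 ∂P
  have hδ0 : ∀ j ∈ Finset.range k, 0 ≤ δ j := fun j hj ↦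
    (hδ j ((Finset.mem_range.1 hj).trans_le hk)).le
  have htime : time δ k ≤ T := (time_mem_Icc hδ hsum hk).2
  have hdrift : ∑ j ∈ Finset.range k, δ j * ∫ ω, ‖b (sgld G θ₀ δ U W j ω)‖ ^ 2 ∂P ≤
      ∑ j ∈ Finset.range k, δ j * (L * v j) :=
    Finset.sum_le_sum fun j hj ↦ mul_le_mul_of_nonneg_left
      (integral_norm_sq_comp_le_of_lipschitzWith hb (hU.memLp_sgld hG hb j)) (hδ0 j hj)
  have herror : ∫ ω, ‖∑ j ∈ Finset.range k, stepError b G θ₀ δ U W j ω‖ ^ 2 ∂P ≤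
      ∑ j ∈ Finset.range k, T * δ j * (C * v j) := by
    refine (hU.integral_norm_sum_stepError_sq_le hG hb k).trans (Finset.sum_le_sum fun j hj ↦ ?_)
    have hδT : δ j ≤ T := (Finset.single_le_sum hδ0 hj).trans htime
    have hδj := hδ0 j hj
    rw [sq]
    gcongr
  calc v k
      ≤ 1 + 4 * (‖θ₀‖ ^ 2 + T * ∑ j ∈ Finset.range k, δ j * (L * v j) +
          ∑ j ∈ Finset.range k, T * δ j * (C * v j) + d * T) := by
        refine add_le_add_right ((hU.integral_norm_sq_sgld_le hG hb hT hδ hsum hk).trans ?_) 1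
        gcongr
    _ = _ := by
        have hrate : ∑ j ∈ Finset.range k, momentRate b K C T * δ j * v j =
            4 * (T * ∑ j ∈ Finset.range k, δ j * (L * v j) +
              ∑ j ∈ Finset.range k, T * δ j * (C * v j)) := by
          simp only [Finset.mul_sum, ← Finset.sum_add_distrib, momentRate, ← hL]
          exact Finset.sum_congr rfl fun j _ ↦ by ring
        rw [hrate]
        ring

theorem one_add_integral_norm_sq_sgld_le (hU : IsDrivingNoise U W ν P)
    (hG : IsDriftEstimate b G ν C) (hb : LipschitzWith K b) (hT : 0 ≤ T) (hδ : ∀ k < m, 0 < δ k)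
    (hsum : time δ m = T) {k : ℕ} (hk : k ≤ m) :
    1 + ∫ ω, ‖sgld G θ₀ δ U W k ω‖ ^ 2 ∂P ≤ momentBound b K C θ₀ T := by
  have hrate : 0 ≤ momentRate b K C T := by unfold momentRate; positivity
  refine (le_mul_exp_sum_of_le_add_sum (by positivity)
    (fun j hj ↦ mul_nonneg hrate (hδ j hj).le)
    (fun j hj ↦ hU.one_add_integral_norm_sq_sgld_le_add_sum hG hb hT hδ hsum hj) k hk).trans ?_
  rw [momentBound, ← Finset.mul_sum]
  gcongr
  exact (time_mem_Icc hδ hsum hk).2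

theorem measure_exists_le_norm_sum_stepError_le (hU : IsDrivingNoise U W ν P)
    (hG : IsDriftEstimate b G ν C) (hb : LipschitzWith K b) (hT : 0 ≤ T) (hδ : ∀ k < m, 0 < δ k)
    (hsum : time δ m = T) {ε : ℝ} (hε : 0 < ε) :
    P {ω | ∃ k ≤ m, ε ≤ ‖∑ j ∈ Finset.range k, stepError b G θ₀ δ U W j ω‖} ≤
      ENNReal.ofReal (mesh δ m * (T * (C * momentBound b K C θ₀ T)) / ε ^ 2) := by
  refine (measure_exists_le_norm_sum_le
    (hU.stronglyMeasurable_stepError hG hb.continuous.measurable) (hU.memLp_stepError hG hb)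
    (hU.condExp_stepError hG hb) m hε).trans ?_
  gcongr
  calc ∑ k ∈ Finset.range m, ∫ ω, ‖stepError b G θ₀ δ U W k ω‖ ^ 2 ∂P
      ≤ ∑ k ∈ Finset.range m, mesh δ m * δ k * (C * momentBound b K C θ₀ T) := by
        refine Finset.sum_le_sum fun k hk ↦ ?_
        have hk := Finset.mem_range.1 hk
        have hδk := (hδ k hk).le
        have hmesh : 0 ≤ mesh δ m := hδk.trans (le_mesh hk)
        refine (hU.integral_norm_sq_stepError_le hG hb k).trans ?_
        rw [sq]
        gcongr
        · exact le_mesh hk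
        · exact hU.one_add_integral_norm_sq_sgld_le hG hb hT hδ hsum hk.le
    _ = mesh δ m * (T * (C * momentBound b K C θ₀ T)) := by
        rw [← hsum, time, Finset.sum_mul, Finset.mul_sum]
        exact Finset.sum_congr rfl fun k _ ↦ by ring

end IsDrivingNoise

end Moments

theorem tendstoInDistribution_of_identDistrib_limit {ι E Ω₁ Ω₂ : Type*} {Ω : ι → Type*}
    [TopologicalSpace E] [MeasurableSpace E] [OpensMeasurableSpace E]
    [∀ i, MeasurableSpace (Ω i)] [MeasurableSpace Ω₁] [MeasurableSpace Ω₂]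
    {P : ∀ i, Measure (Ω i)} [∀ i, IsProbabilityMeasure (P i)] {P₁ : Measure Ω₁}
    [IsProbabilityMeasure P₁] {P₂ : Measure Ω₂} [IsProbabilityMeasure P₂] {l : Filter ι}
    {X : ∀ i, Ω i → E} {Z₁ : Ω₁ → E} {Z₂ : Ω₂ → E}
    (h : TendstoInDistribution X l Z₁ P P₁) (hZ : IdentDistrib Z₁ Z₂ P₁ P₂) :
    TendstoInDistribution X l Z₂ P P₂ where
  forall_aemeasurable := h.forall_aemeasurable
  aemeasurable_limit := hZ.aemeasurable_snd
  tendsto := by simpa only [hZ.map_eq] using h.tendsto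

section Convergence

variable {d : ℕ} {𝒰 Ω : Type*} {b : EuclideanSpace ℝ (Fin d) → EuclideanSpace ℝ (Fin d)}
  {G : EuclideanSpace ℝ (Fin d) → 𝒰 → EuclideanSpace ℝ (Fin d)} {θ₀ : EuclideanSpace ℝ (Fin d)}
  {W : ℝ≥0 → Ω → EuclideanSpace ℝ (Fin d)}

/-- The largest norm that the accumulated gradient errors reach during the first `m` steps. -/
noncomputable def maxError (b : EuclideanSpace ℝ (Fin d) → EuclideanSpace ℝ (Fin d))
    (G : EuclideanSpace ℝ (Fin d) → 𝒰 → EuclideanSpace ℝ (Fin d))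
    (θ₀ : EuclideanSpace ℝ (Fin d)) (δ : ℕ → ℝ) (m : ℕ) (U : ℕ → Ω → 𝒰)
    (W : ℝ≥0 → Ω → EuclideanSpace ℝ (Fin d)) (ω : Ω) : ℝ :=
  (Finset.range (m + 1)).sup' Finset.nonempty_range_add_one
    fun k ↦ ‖∑ j ∈ Finset.range k, stepError b G θ₀ δ U W j ω‖

theorem norm_sum_stepError_le_maxError {δ : ℕ → ℝ} {U : ℕ → Ω → 𝒰} {m k : ℕ} (hk : k ≤ m) (ω : Ω) :
    ‖∑ j ∈ Finset.range k, stepError b G θ₀ δ U W j ω‖ ≤ maxError b G θ₀ δ m U W ω :=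
  Finset.le_sup' (fun k ↦ ‖∑ j ∈ Finset.range k, stepError b G θ₀ δ U W j ω‖)
    (Finset.mem_range_succ_iff.2 hk)

theorem le_maxError_iff {δ : ℕ → ℝ} {U : ℕ → Ω → 𝒰} {m : ℕ} {ε : ℝ} {ω : Ω} :
    ε ≤ maxError b G θ₀ δ m U W ω ↔
      ∃ k ≤ m, ε ≤ ‖∑ j ∈ Finset.range k, stepError b G θ₀ δ U W j ω‖ := by
  simp only [maxError, Finset.le_sup'_iff, Finset.mem_range_succ_iff]

variable [MeasurableSpace 𝒰] [MeasurableSpace Ω] {P : Measure Ω} {ν : Measure 𝒰}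

theorem measurable_interpolation_sgld {δ : ℕ → ℝ} {U : ℕ → Ω → 𝒰} (hU : IsDrivingNoise U W ν P)
    (hG : Measurable (Function.uncurry G)) (T : ℝ) (m : ℕ) :
    Measurable fun ω ↦ interpolation T δ m fun k ↦ sgld G θ₀ δ U W k ω :=
  measurable_interpolation T δ m fun _ ↦
    measurable_sgld hG hU.brownian.measurable fun j _ ↦ hU.measurable j

variable [IsProbabilityMeasure P] {C K : ℝ≥0} {T : ℝ} {δ : ℕ → ℕ → ℝ} {m : ℕ → ℕ}
  {U : ℕ → ℕ → Ω → 𝒰} {X : Ω → PathSpace d T}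

theorem tendstoInMeasure_maxError (hU : ∀ r, IsDrivingNoise (U r) W ν P)
    (hG : IsDriftEstimate b G ν C) (hb : LipschitzWith K b) (hT : 0 ≤ T)
    (hδ : ∀ r, ∀ k < m r, 0 < δ r k) (hsum : ∀ r, time (δ r) (m r) = T)
    (hmesh : Tendsto (fun r ↦ mesh (δ r) (m r)) atTop (𝓝 0)) :
    TendstoInMeasure P (fun r ↦ maxError b G θ₀ (δ r) (m r) (U r) W) atTop 0 := by
  rw [tendstoInMeasure_iff_norm]
  intro ε hε
  have hbound : Tendsto (fun r ↦ ENNReal.ofReal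
      (mesh (δ r) (m r) * (T * (C * momentBound b K C θ₀ T)) / ε ^ 2)) atTop (𝓝 0) := by
    have hreal := (hmesh.mul_const (T * (C * momentBound b K C θ₀ T))).div_const (ε ^ 2)
    simpa only [zero_mul, zero_div, ENNReal.ofReal_zero] using ENNReal.tendsto_ofReal hreal
  refine tendsto_of_tendsto_of_tendsto_of_le_of_le tendsto_const_nhds hbound (fun _ ↦ zero_le)
    fun r ↦ (measure_mono fun ω hω ↦ ?_).trans
      ((hU r).measure_exists_le_norm_sum_stepError_le hG hb hT (hδ r) (hsum r) hε)
  have hnonneg : 0 ≤ maxError b G θ₀ (δ r) (m r) (U r) W ω :=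
    (norm_nonneg _).trans (norm_sum_stepError_le_maxError (Nat.zero_le _) ω)
  rw [Set.mem_ofPred_eq, Pi.zero_apply, sub_zero, Real.norm_of_nonneg hnonneg] at hω
  exact le_maxError_iff.1 hω

theorem IsSolution.tendstoInMeasure_interpolation_sgld (hT : 0 < T)
    (hX : IsSolution b θ₀ hT.le P W X) (hU : ∀ r, IsDrivingNoise (U r) W ν P)
    (hG : IsDriftEstimate b G ν C) (hb : LipschitzWith K b)
    (hδ : ∀ r, ∀ k < m r, 0 < δ r k) (hsum : ∀ r, time (δ r) (m r) = T)
    (hmesh : Tendsto (fun r ↦ mesh (δ r) (m r)) atTop (𝓝 0)) :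
    TendstoInMeasure P (fun r ω ↦ interpolation T (δ r) (m r)
      fun k ↦ sgld G θ₀ (δ r) (U r) W k ω) atTop X := by
  rw [exists_seq_tendstoInMeasure_atTop_iff fun r ↦
    (measurable_interpolation_sgld (hU r) hG.measurable T (m r)).aestronglyMeasurable]
  intro ns hns
  obtain ⟨ms, hms, herror⟩ := ((tendstoInMeasure_maxError (θ₀ := θ₀) hU hG hb hT.le hδ hsum
    hmesh).comp hns.tendsto_atTop).exists_seq_tendsto_ae
  obtain ⟨w, -, hw⟩ := hX.brownian.exists_measurable_path T
  refine ⟨ms, hms, ?_⟩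
  filter_upwards [herror, hw, hX.brownian.ae_eq_zero, hX.ae_eq_solutionMap hb hw]
    with ω hω hpath hzero hsolution
  rw [hsolution]
  exact tendsto_interpolation_of_isPerturbedEuler hT
    (fun i ↦ isPerturbedEuler_sgld b hT.le (hδ (ns (ms i))) (hsum (ns (ms i))) hpath hzero)
    hb (picard_solutionMap hT.le hb θ₀ (w ω)) (fun i ↦ hδ (ns (ms i)))
    (fun i ↦ hsum (ns (ms i))) (hmesh.comp (hns.comp hms).tendsto_atTop)
    (fun i k hk ↦ norm_sum_stepError_le_maxError hk ω) hω

end Convergence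

section Lyapunov

theorem lipschitzWith_sqrt_of_norm_fderiv_sq_le {E : Type*} [NormedAddCommGroup E]
    [NormedSpace ℝ E] {V : E → ℝ} {C : ℝ≥0} (hV : Differentiable ℝ V) (hpos : ∀ x, 0 < V x)
    (h : ∀ x, ‖fderiv ℝ V x‖ ^ 2 ≤ C * V x) :
    LipschitzWith (NNReal.sqrt C / 2) fun x ↦ √(V x) := by
  refine lipschitzWith_of_nnnorm_fderiv_le (𝕜 := ℝ) (fun x ↦ (hV x).sqrt (hpos x).ne') fun x ↦ ?_
  have hsqrt : 0 < √(V x) := Real.sqrt_pos.2 (hpos x)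
  have hfderiv : ‖fderiv ℝ V x‖ ≤ √C * √(V x) := by
    rw [← Real.sqrt_mul C.coe_nonneg]
    exact Real.le_sqrt_of_sq_le (h x)
  rw [← NNReal.coe_le_coe, coe_nnnorm, fderiv_sqrt (hV x) (hpos x).ne', norm_smul,
    Real.norm_of_nonneg (by positivity)]
  calc 1 / (2 * √(V x)) * ‖fderiv ℝ V x‖
      ≤ 1 / (2 * √(V x)) * (√C * √(V x)) := by gcongr
    _ = ↑(NNReal.sqrt C / 2) := by
        push_cast
        field_simp

theorem le_mul_one_add_norm_sq_of_norm_fderiv_sq_le {E : Type*} [NormedAddCommGroup E]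
    [NormedSpace ℝ E] {V : E → ℝ} {C : ℝ≥0} (hV : Differentiable ℝ V) (hpos : ∀ x, 0 < V x)
    (h : ∀ x, ‖fderiv ℝ V x‖ ^ 2 ≤ C * V x) (x : E) :
    V x ≤ (2 * V 0 + C / 2) * (1 + ‖x‖ ^ 2) := by
  have hgrowth := norm_sq_le_of_lipschitzWith (lipschitzWith_sqrt_of_norm_fderiv_sq_le hV hpos h) x
  simp only [Real.norm_eq_abs, sq_abs, Real.sq_sqrt (hpos _).le] at hgrowth
  convert hgrowth using 2
  push_cast
  rw [div_pow, Real.sq_sqrt C.coe_nonneg]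
  ring

theorem lintegral_le_lintegral_rpow {α : Type*} [MeasurableSpace α] {μ : Measure α}
    [IsProbabilityMeasure μ] {f : α → ℝ≥0∞} (hf : AEMeasurable f μ) {p : ℝ} (hp : 1 ≤ p) :
    ∫⁻ x, f x ∂μ ≤ (∫⁻ x, f x ^ p ∂μ) ^ p⁻¹ := by
  have hmono := eLpNorm'_le_eLpNorm'_of_exponent_le one_pos hp μ hf.aestronglyMeasurable
  simpa only [eLpNorm'_eq_lintegral_enorm, enorm_eq_self, ENNReal.rpow_one, one_div, inv_one]
    using hmono

variable {d : ℕ} {𝒰 : Type*} {π V : EuclideanSpace ℝ (Fin d) → ℝ}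
  {G : EuclideanSpace ℝ (Fin d) → 𝒰 → EuclideanSpace ℝ (Fin d)}

theorem driftError_drift (θ : EuclideanSpace ℝ (Fin d)) (u : 𝒰) :
    driftError (drift π) G θ u = (1 / 2 : ℝ) • (G θ u - gradLog π θ) :=
  (smul_sub _ _ _).symm

variable [MeasurableSpace 𝒰] {ν : Measure 𝒰}

theorem IsLyapunov.exists_le_mul_one_add_norm_sq (hV : IsLyapunov π G ν V) :
    ∃ A : ℝ≥0, ∀ θ, V θ ≤ A * (1 + ‖θ‖ ^ 2) := by
  obtain ⟨C, hC, hsize⟩ := hV.size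
  lift C to ℝ≥0 using hC.le
  have hfderiv (θ) : ‖fderiv ℝ V θ‖ ^ 2 ≤ C * V θ := by
    have hnorm : ‖gradient V θ‖ = ‖fderiv ℝ V θ‖ := LinearIsometryEquiv.norm_map _ _
    rw [← hnorm]
    linarith [hsize θ, sq_nonneg ‖gradLog π θ‖]
  have hpos (θ) : 0 < V θ := one_pos.trans_le (hV.one_le θ)
  refine ⟨⟨2 * V 0 + C / 2, ?_⟩,
    le_mul_one_add_norm_sq_of_norm_fderiv_sq_le hV.differentiable hpos hfderiv⟩
  have := hpos 0
  positivity

theorem IsUnbiasedEstimate.integral_driftError [IsProbabilityMeasure ν]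
    (hG : IsUnbiasedEstimate π G ν) (θ : EuclideanSpace ℝ (Fin d)) :
    ∫ u, driftError (drift π) G θ u ∂ν = 0 := by
  simp only [driftError_drift]
  rw [integral_smul, integral_sub (hG.integrable θ) (integrable_const _), hG.integral_eq,
    integral_const, probReal_univ, one_smul, sub_self, smul_zero]

theorem IsUnbiasedEstimate.exists_isDriftEstimate [IsProbabilityMeasure ν]
    (hG : IsUnbiasedEstimate π G ν) (hV : IsLyapunov π G ν V) :
    ∃ C : ℝ≥0, IsDriftEstimate (drift π) G ν C := by
  obtain ⟨p, hp, C, hC, hmoment⟩ := hV.moment_error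
  obtain ⟨A, hA⟩ := hV.exists_le_mul_one_add_norm_sq
  lift C to ℝ≥0 using hC.le
  refine ⟨C ^ p⁻¹ * A, hG.measurable, hG.integral_driftError, fun θ ↦ ?_⟩
  have hVθ : 0 ≤ V θ := zero_le_one.trans (hV.one_le θ)
  have herror : AEStronglyMeasurable (fun u ↦ G θ u - gradLog π θ) ν :=
    (hG.integrable θ).1.sub aestronglyMeasurable_const
  have hhalf : ‖(1 / 2 : ℝ)‖ₑ ≤ 1 := by
    rw [Real.enorm_of_nonneg (by norm_num), ENNReal.ofReal_le_one]
    norm_num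
  calc ∫⁻ u, ‖driftError (drift π) G θ u‖ₑ ^ 2 ∂ν
      ≤ ∫⁻ u, ‖G θ u - gradLog π θ‖ₑ ^ 2 ∂ν := by
        gcongr with u
        rw [driftError_drift, enorm_smul]
        exact mul_le_of_le_one_left' hhalf
    _ ≤ (∫⁻ u, (‖G θ u - gradLog π θ‖ₑ ^ 2) ^ p ∂ν) ^ p⁻¹ :=
        lintegral_le_lintegral_rpow (herror.enorm.pow_const 2) (by linarith)
    _ ≤ ENNReal.ofReal (C * V θ ^ p) ^ p⁻¹ := by
        gcongr
        simpa only [ENNReal.rpow_mul, ENNReal.rpow_ofNat] using hmoment θ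
    _ = ENNReal.ofReal (C ^ p⁻¹ * V θ) := by
        rw [ENNReal.ofReal_rpow_of_nonneg (by positivity) (by positivity),
          Real.mul_rpow C.coe_nonneg (by positivity), Real.rpow_rpow_inv hVθ (by linarith)]
    _ ≤ ENNReal.ofReal (↑(C ^ p⁻¹ * A) * (1 + ‖θ‖ ^ 2)) := by
        rw [NNReal.coe_mul, NNReal.coe_rpow, mul_assoc]
        gcongr
        exact hA θ

end Lyapunov

end SGLD

theorem theorem3_general {d : ℕ} {𝒰 : Type*} [MeasurableSpace 𝒰] {Ω : Type*} [MeasurableSpace Ω]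
    (P : Measure Ω) [IsProbabilityMeasure P] (ν : Measure 𝒰)
    (b : EuclideanSpace ℝ (Fin d) → EuclideanSpace ℝ (Fin d)) {K : ℝ≥0} (hb : LipschitzWith K b)
    (G : EuclideanSpace ℝ (Fin d) → 𝒰 → EuclideanSpace ℝ (Fin d)) {C : ℝ≥0}
    (hG : SGLD.IsDriftEstimate b G ν C)
    (T : ℝ) (hT : 0 < T) (m : ℕ → ℕ) (δ : ℕ → ℕ → ℝ) (hδ : ∀ r, ∀ k < m r, 0 < δ r k)
    (hsum : ∀ r, SGLD.time (δ r) (m r) = T)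
    (hmesh : Tendsto (fun r ↦ SGLD.mesh (δ r) (m r)) atTop (𝓝 0))
    (W : ℝ≥0 → Ω → EuclideanSpace ℝ (Fin d)) (U : ℕ → ℕ → Ω → 𝒰)
    (hU : ∀ r, SGLD.IsDrivingNoise (U r) W ν P) (θ₀ : EuclideanSpace ℝ (Fin d)) :
    (∃ X : Ω → SGLD.PathSpace d T, SGLD.IsSolution b θ₀ hT.le P W X) ∧
    ∀ (Ω' : Type*) [MeasurableSpace Ω'] (P' : Measure Ω') [IsProbabilityMeasure P']
      (W' : ℝ≥0 → Ω' → EuclideanSpace ℝ (Fin d)) (X' : Ω' → SGLD.PathSpace d T),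
      SGLD.IsSolution b θ₀ hT.le P' W' X' →
      TendstoInDistribution
        (fun r ω ↦ SGLD.interpolation T (δ r) (m r)
          (SGLD.chain G θ₀ (δ r) (fun k ↦ U r k ω) (SGLD.noise (fun t ↦ W t ω) (δ r))))
        atTop X' (fun _ ↦ P) P' := by
  obtain ⟨X, hX⟩ := (hU 0).brownian.exists_isSolution hb θ₀ hT.le
  have hconv := (hX.tendstoInMeasure_interpolation_sgld hT hU hG hb hδ hsum
    hmesh).tendstoInDistribution fun r ↦
      (SGLD.measurable_interpolation_sgld (hU r) hG.measurable T (m r)).aemeasurable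
  exact ⟨⟨X, hX⟩, fun Ω' _ P' _ W' X' hX' ↦
    SGLD.tendstoInDistribution_of_identDistrib_limit hconv (hX.identDistrib hb hX')⟩

theorem theorem3 {d : ℕ} {𝒰 : Type*} [MeasurableSpace 𝒰]
    {Ω : Type*} [MeasurableSpace Ω] (P : Measure Ω) [IsProbabilityMeasure P]
    -- the target density, the stochastic gradient and the law of the auxiliary variables
    (π : EuclideanSpace ℝ (Fin d) → ℝ) (hπ : SGLD.IsPositiveDensity π)
    (ν : Measure 𝒰) [IsProbabilityMeasure ν]
    (G : EuclideanSpace ℝ (Fin d) → 𝒰 → EuclideanSpace ℝ (Fin d))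
    (hG : SGLD.IsUnbiasedEstimate π G ν)
    (hStab : SGLD.StabilityAssumption π G ν)
    (hLip : ∃ K : ℝ≥0, LipschitzWith K (SGLD.drift π))
    -- the step-sizes
    (T : ℝ) (hT : 0 < T) (m : ℕ → ℕ) (δ : ℕ → ℕ → ℝ)
    (hδ : ∀ r, ∀ k < m r, 0 < δ r k)
    (hsum : ∀ r, ∑ k ∈ Finset.range (m r), δ r k = T)
    (hmesh : Tendsto (fun r ↦ SGLD.mesh (δ r) (m r)) atTop (𝓝 0))
    -- the Brownian motion and the auxiliary variables
    (W : ℝ≥0 → Ω → EuclideanSpace ℝ (Fin d)) (hW : SGLD.IsStandardBM W P)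
    (U : ℕ → ℕ → Ω → 𝒰) (hUmeas : ∀ r k, Measurable (U r k))
    (hUlaw : ∀ r k, P.map (U r k) = ν)
    (hUindep : iIndepFun (fun p : ℕ × ℕ ↦ U p.1 p.2) P)
    (hUW : IndepFun (fun (ω : Ω) (p : ℕ × ℕ) ↦ U p.1 p.2 ω) (fun (ω : Ω) (t : ℝ≥0) ↦ W t ω) P)
    (θ₀ : EuclideanSpace ℝ (Fin d)) :
    -- the Langevin diffusion exists
    (∃ X : Ω → SGLD.PathSpace d T, SGLD.IsLangevinDiffusion π θ₀ T hT.le P W X) ∧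
    -- and the interpolated chains converge weakly to it, on whatever space it is realised
    ∀ (Ω' : Type*) [MeasurableSpace Ω'] (P' : Measure Ω') [IsProbabilityMeasure P']
      (W' : ℝ≥0 → Ω' → EuclideanSpace ℝ (Fin d)) (X' : Ω' → SGLD.PathSpace d T),
      SGLD.IsLangevinDiffusion π θ₀ T hT.le P' W' X' →
      TendstoInDistribution
        (fun r ω ↦ SGLD.interpolation T (δ r) (m r)
          (SGLD.chain G θ₀ (δ r) (fun k ↦ U r k ω) (SGLD.noise (fun t ↦ W t ω) (δ r))))
        atTop X' (fun _ ↦ P) P' := by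
  obtain ⟨K, hb⟩ := hLip
  obtain ⟨-, -, V, hV⟩ := hStab
  obtain ⟨C, hDrift⟩ := hG.exists_isDriftEstimate hV
  have hU (r : ℕ) : SGLD.IsDrivingNoise (U r) W ν P :=
    { brownian := hW
      measurable := hUmeas r
      map_eq := hUlaw r
      indep := hUindep.precomp (g := fun k : ℕ ↦ (r, k)) (Prod.mk_right_injective r)
      indep_brownian := hUW.comp (φ := fun (y : ℕ × ℕ → 𝒰) (k : ℕ) ↦ y (r, k)) (by fun_prop)
        measurable_id }
  simpa only [SGLD.isLangevinDiffusion_iff] using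
    theorem3_general P ν _ hb G hDrift T hT m δ hδ hsum hmesh W U hU θ₀
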